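/- **Theorem 6 (Consistent treatment allocation).** *Experiment.* Participants $i=1,\dots,N$ are enrolled in stages $S_i\in\{1,\dots,T\}$ (nonrandom), $n_t$ of them in stage $t$. Participant $i$ has a covariate $X_i\in\mathcal X$, potential outcomes $Y_i(0),Y_i(1)$, a treatment $A_i\in\{0,1\}$, an outcome $Y_i=Y_i(A_i)$ and a delay $D_i\in\{0,1,2,\dots\}\cup\{\infty\}$; $Y_i$ is available at the end of stage $t$ if and only if $D_i+S_i\le t$. Let $\mathcal H_t$ be the σ-algebra of what is observed by the end of stage $t$: $X_i$ and $A_i$ for all $i$ with $S_i\le t$, and $D_i,Y_i$ for those with $D_i+S_i\le t$ (whether they are available is also observed). The probability of arm $a$ in stage $t$ given covariate $x$ is $\hat e^*_t(a|x)$, with $\hat e^*_t(0|x)=1-\hat e^*_t(1|x)$. *Feasible design.* Fix $\delta\in(0,1/2)$. Set $\hat e^*_1(a|x)=1/2$. For $1\le t<T$ let, with the convention $0/0=0$, $\hat r_\ell=n_\ell/N$, let $\hat p_t(x)$ be the share of $X_i=x$ among $S_i\le t$, let $\hat\sigma^2_t(x,a)$ be the empirical variance (with divisor the number of terms) of the $Y_i$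 with $X_i=x$, $A_i=a$, $D_i+S_i\le t$, and let $$\hat\rho_t(d|x,a)=\sum_{\ell=0}^{d}\frac{\#\{i: X_i=x,A_i=a,D_i=\ell,S_i\le t-\ell\}}{\#\{i: X_i=x,A_i=a,S_i\le t-\ell\}}\quad(d<t),\qquad \hat\rho_t(d|x,a)=\hat\rho_t(t-1|x,a)\quad(d\ge t)$$ (conservative extrapolation). A plan $(e_{t+1}(\cdot),\dots,e_T(\cdot))$ with values in $[\delta,1-\delta]$ is chosen that minimizes over all such plans $$\sum_{x\in\mathcal X}\hat p_t(x)\Bigg[\frac{\hat\sigma_t^2(x,1)}{\sum_{\ell=1}^t \hat r_\ell\hat\rho_t(T-\ell|x,1)\hat e^*_\ell(1|x)+\sum_{\ell=t+1}^T\hat r_\ell\hat\rho_t(T-\ell|x,1)e_\ell(x)}+\frac{\hat\sigma_t^2(x,0)}{\sum_{\ell=1}^t \hat r_\ell\hat\rho_t(T-\ell|x,0)\hat e^*_\ell(0|x)+\sum_{\ell=t+1}^T\hat r_\ell\hat\rho_t(T-\ell|x,0)(1-e_\ell(x))}\Bigg]$$ and satisfies the tie-breaking rule: if $t\le T/2$,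 then for each $x$, $\max\{e_{t+2}(x),\dots,e_{T-t+1}(x)\}>\delta$ only if $e_{t+1}(x)=1-\delta$. Then $\hat e^*_{t+1}(1|x)=e_{t+1}(x)$. *Assumptions.* 1. $(X_i,Y_i(0),Y_i(1))$ are i.i.d. across $i$; $\mathcal X$ is finite and $p(x)=\mathbb P[X_i=x]>0$ for all $x$; $\mathbb E[Y_i(a)^4|X_i=x]<\infty$. With $\sigma^2(x,a)=\mathbb V[Y_i(a)|X_i=x]$, for each $x$ at least one of $\sigma^2(x,0),\sigma^2(x,1)$ is nonzero. 2. $\hat e^*_t(\cdot|x)$ is $\mathcal H_{t-1}$-measurable. For a participant of stage $t$: $(X_i,Y_i(0),Y_i(1))$ is independent of $\mathcal H_{t-1}$; given $\mathcal H_{t-1}$, $X_i$ and $(Y_i(0),Y_i(1))$, treatment $a$ is assigned with probability $\hat e^*_t(a|X_i)$; and given all these and $A_i$, $\mathbb P[D_i\le d\mid\cdot]=\rho(d|X_i,A_i)$, with $\rho$ not depending on $t$. The participants of one stage $t$ are conditionally independent of each other given $\mathcal H_{t-1}$. 3. $\rho(0|x,a)>0$ for all $x,a$. (Every $\hat e^*_t(a|x)\ge\delta$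 by design.) 4. $T$ is fixed, and along the asymptotic sequence of experiments, in which the law of $(X_i,Y_i(0),Y_i(1))$, $\rho$, $T$ and $\delta$ stay the same, $n_t\to\infty$ and $n_t/N\to r_t>0$ for all $t$. 5. For each $x$ and all $d\ne d'$ in $\{0,\dots,T-1\}$, $\rho(d|x,1)/\rho(d|x,0)\ne\rho(d'|x,1)/\rho(d'|x,0)$. *Limit allocation.* $e^\dagger_t$ is defined by the same recursion in the population: $e_1^\dagger(a|x)=1/2$, and for $1\le t<T$, $e^\dagger_{t+1}(1|x)=1-e^\dagger_{t+1}(0|x)=e_{t+1}(x)$ for a plan $(e_{t+1}(\cdot),\dots,e_T(\cdot))$ with values in $[\delta,1-\delta]$ that satisfies the same tie-breaking rule and minimizes the above objective with $\hat p_t,\hat\sigma^2_t,\hat r_\ell,\hat e^*_\ell$ replaced by $p,\sigma^2,r_\ell,e^\dagger_\ell$, and $\hat\rho_t$ replaced by $\rho^\dagger_t(d|x,a)=\rho(\min\{d,t-1\}|x,a)$. *Conclusion.* Such an $e^\dagger$ exists, and for any such $e^\dagger$, $\hat e^*_t(a|x)\to e^\dagger_t(a|x)$ in probability for all $t=1,\dots,T$,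 $x\in\mathcal X$ and $a\in\{0,1\}$. (In particular $e^\dagger_t$ is unique for $t\le T$.) -/

import Mathlib

open MeasureTheory ProbabilityTheory Filter Topology

namespace DelayedCARA

noncomputable section

/-! ### The population

`Q` is the joint law of `(X, (Y(0), Y(1)))`, and `ρ d x a` is the probability that the outcome is
delayed by at most `d` stages, given covariate value `x` and treatment `a`. -/

/-- `p(x) = ℙ[X = x]`. -/
def covProb {𝒳 : Type*} [MeasurableSpace 𝒳] (Q : Measure (𝒳 × (Fin 2 → ℝ))) (x : 𝒳) : ℝ :=
  Q.real {z | z.1 = x}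

/-- The conditional law of `(X, (Y(0), Y(1)))` given `X = x`. -/
def condLaw {𝒳 : Type*} [MeasurableSpace 𝒳] (Q : Measure (𝒳 × (Fin 2 → ℝ))) (x : 𝒳) :
    Measure (𝒳 × (Fin 2 → ℝ)) :=
  ProbabilityTheory.cond Q {z | z.1 = x}

/-- `μ_s(x, a) = 𝔼[Y(a)^s | X = x]`. -/
def condMoment {𝒳 : Type*} [MeasurableSpace 𝒳] (Q : Measure (𝒳 × (Fin 2 → ℝ)))
    (s : ℕ) (x : 𝒳) (a : Fin 2) : ℝ :=
  ∫ z, (z.2 a) ^ s ∂(condLaw Q x)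

/-- `σ²(x, a) = μ₂(x, a) - μ₁(x, a)²`. -/
def condVariance {𝒳 : Type*} [MeasurableSpace 𝒳] (Q : Measure (𝒳 × (Fin 2 → ℝ)))
    (x : 𝒳) (a : Fin 2) : ℝ :=
  condMoment Q 2 x a - (condMoment Q 1 x a) ^ 2

/-! ### Allocation rules, the forward-looking objective and its optimal plans

An allocation rule is given by the probability `e` of arm `1`; stages are numbered `1, …, T`, so
that `e ℓ x` is the probability of arm `1` for covariate value `x` in stage `ℓ`. -/

/-- The probability of arm `a` when arm `1` has probability `e`. -/
def armProb (e : ℝ) (a : Fin 2) : ℝ := if a = 1 then e else 1 - e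

/-- The fully forward-looking objective at the end of stage `t`, as a function of the future
allocations `u (t+1), …, u T`, for covariate weights `p`, outcome variances `v`, enrolment shares
`r`, delay probabilities `ρ` and past allocations `past 1, …, past t`. -/
def forwardObjective {𝒳 : Type*} [Fintype 𝒳] (T t : ℕ) (p : 𝒳 → ℝ) (v : 𝒳 → Fin 2 → ℝ)
    (r : ℕ → ℝ) (ρ : ℕ → 𝒳 → Fin 2 → ℝ) (past : ℕ → 𝒳 → ℝ) (u : ℕ → 𝒳 → ℝ) : ℝ :=
  ∑ x, p x *
    (v x 1 / ((∑ ℓ ∈ Finset.Icc 1 t, r ℓ * ρ (T - ℓ) x 1 * past ℓ x)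
        + ∑ ℓ ∈ Finset.Icc (t + 1) T, r ℓ * ρ (T - ℓ) x 1 * u ℓ x)
      + v x 0 / ((∑ ℓ ∈ Finset.Icc 1 t, r ℓ * ρ (T - ℓ) x 0 * (1 - past ℓ x))
        + ∑ ℓ ∈ Finset.Icc (t + 1) T, r ℓ * ρ (T - ℓ) x 0 * (1 - u ℓ x)))

/-- The plan `u` respects the bounds `[δ, 1 - δ]` in all future stages `t+1, …, T`. -/
def FeasiblePlan {𝒳 : Type*} (δ : ℝ) (T t : ℕ) (u : ℕ → 𝒳 → ℝ) : Prop :=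
  ∀ ℓ ∈ Finset.Icc (t + 1) T, ∀ x, u ℓ x ∈ Set.Icc δ (1 - δ)

/-- The tie-breaking rule for a plan made at the end of stage `t ≤ T / 2`: one of the stages
`t+2, …, T-t+1` may exceed the lower bound only if stage `t+1` attains the upper bound. -/
def TieBreaking {𝒳 : Type*} (δ : ℝ) (T t : ℕ) (u : ℕ → 𝒳 → ℝ) : Prop :=
  2 * t ≤ T → ∀ x, (∃ ℓ ∈ Finset.Icc (t + 2) (T - t + 1), δ < u ℓ x) → u (t + 1) x = 1 - δ

/-- `u` is a minimizer of the objective `V` over the feasible plans and obeys the tie-breaking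
rule. -/
structure IsOptimalPlan {𝒳 : Type*} (δ : ℝ) (T t : ℕ) (V : (ℕ → 𝒳 → ℝ) → ℝ)
    (u : ℕ → 𝒳 → ℝ) : Prop where
  feasible : FeasiblePlan δ T t u
  minimal : ∀ u', FeasiblePlan δ T t u' → V u ≤ V u'
  tieBreaking : TieBreaking δ T t u

/-- Conservative extrapolation at the end of stage `t`: the delay probabilities `ρ d` are kept for
`d < t` and replaced by `ρ (t - 1)` for `d ≥ t`. -/
def conservative {𝒳 : Type*} (ρ : ℕ → 𝒳 → Fin 2 → ℝ) (t d : ℕ) (x : 𝒳) (a : Fin 2) : ℝ :=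
  if d < t then ρ d x a else ρ (t - 1) x a

/-- `e` is (the probability of arm `1` under) the deterministic allocation `e†`: it starts at
`1 / 2`, and `e (t + 1)` is the stage-`(t + 1)` component of an optimal plan for the population
objective at the end of stage `t`, with conservatively extrapolated delay probabilities. -/
structure IsLimitAllocation {𝒳 : Type*} [Fintype 𝒳] (δ : ℝ) (T : ℕ) (p : 𝒳 → ℝ)
    (v : 𝒳 → Fin 2 → ℝ) (r : ℕ → ℝ) (ρ : ℕ → 𝒳 → Fin 2 → ℝ) (e : ℕ → 𝒳 → ℝ) : Prop where
  initial : ∀ x, e 1 x = 1 / 2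
  step : ∀ t, 1 ≤ t → t < T →
    ∃ u, IsOptimalPlan δ T t (forwardObjective T t p v r (conservative ρ t) e) u ∧
      ∀ x, e (t + 1) x = u (t + 1) x

/-! ### The experiment and its estimators -/

/-- The data of an adaptive experiment: sample size, enrolment stages, covariates, potential
outcomes, treatments, delays (`⊤` if the outcome never becomes available), and the allocations in
use, `e t x` being the (random) probability of arm `1` for covariate value `x` in stage `t`. -/
structure Experiment (Ω 𝒳 : Type*) where
  N : ℕ
  S : Fin N → ℕ
  X : Fin N → Ω → 𝒳
  Y : Fin N → Ω → Fin 2 → ℝ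
  A : Fin N → Ω → Fin 2
  D : Fin N → Ω → ℕ∞
  e : ℕ → 𝒳 → Ω → ℝ

namespace Experiment

variable {Ω 𝒳 : Type*} (E : Experiment Ω 𝒳)

/-- Covariate and potential outcomes of participant `i`. -/
def W (i : Fin E.N) (ω : Ω) : 𝒳 × (Fin 2 → ℝ) := (E.X i ω, E.Y i ω)

/-- All variables of participant `i`. -/
def Z (i : Fin E.N) (ω : Ω) : 𝒳 × (Fin 2 → ℝ) × Fin 2 × ℕ∞ :=
  (E.X i ω, E.Y i ω, E.A i ω, E.D i ω)

/-- The realized outcome `Y_i = Y_i(A_i)`. -/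
def outcome (i : Fin E.N) (ω : Ω) : ℝ := E.Y i ω (E.A i ω)

/-- The outcome of participant `i` is available at the end of stage `t`. -/
def Available (t : ℕ) (i : Fin E.N) (ω : Ω) : Prop := E.D i ω + (E.S i : ℕ∞) ≤ (t : ℕ∞)

open Classical in
/-- What the experimenter knows of an enrolled participant `i` at the end of stage `t`: covariate,
treatment, and, once the outcome is available, the delay and the outcome. (A delay `⊤` in the
record says that the outcome is not yet available.) -/
def record (t : ℕ) (i : Fin E.N) (ω : Ω) : 𝒳 × Fin 2 × ℕ∞ × ℝ :=
  (E.X i ω, E.A i ω, if E.Available t i ω then E.D i ω else ⊤,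
    if E.Available t i ω then E.outcome i ω else 0)

/-- The history `ℋ_t`: the σ-algebra generated by the records, at the end of stage `t`, of all
participants enrolled in stages `1, …, t`. -/
abbrev history [MeasurableSpace 𝒳] (t : ℕ) : MeasurableSpace Ω :=
  ⨆ i : Fin E.N, ⨆ _ : E.S i ≤ t, MeasurableSpace.comap (E.record t i) inferInstance

/-- `n_t`, the number of participants enrolled in stage `t`. -/
def stageSize (t : ℕ) : ℕ := (Finset.univ.filter fun i => E.S i = t).card

/-- `n_t / N`. -/
def rHat (t : ℕ) : ℝ := (E.stageSize t : ℝ) / (E.N : ℝ)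

open Classical in
/-- The share of participants with covariate `x` among those enrolled in stages `1, …, t`. -/
def pHat (t : ℕ) (x : 𝒳) (ω : Ω) : ℝ :=
  ((Finset.univ.filter fun i => E.X i ω = x ∧ E.S i ≤ t).card : ℝ) /
    ((Finset.univ.filter fun i => E.S i ≤ t).card : ℝ)

open Classical in
/-- The participants with covariate `x` and treatment `a` whose outcome is available at the end
of stage `t`. -/
def availableCell (t : ℕ) (x : 𝒳) (a : Fin 2) (ω : Ω) : Finset (Fin E.N) :=
  Finset.univ.filter fun i => E.X i ω = x ∧ E.A i ω = a ∧ E.Available t i ω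

/-- `μ̂_{1,t}(x, a)`. -/
def muHat (t : ℕ) (x : 𝒳) (a : Fin 2) (ω : Ω) : ℝ :=
  (∑ i ∈ E.availableCell t x a ω, E.outcome i ω) / ((E.availableCell t x a ω).card : ℝ)

/-- `σ̂²_t(x, a)`. -/
def sigmaSqHat (t : ℕ) (x : 𝒳) (a : Fin 2) (ω : Ω) : ℝ :=
  (∑ i ∈ E.availableCell t x a ω, (E.outcome i ω - E.muHat t x a ω) ^ 2) /
    ((E.availableCell t x a ω).card : ℝ)

open Classical in
/-- The estimate at the end of stage `t` of `ℙ[D = ℓ | X = x, A = a]`. It uses the participants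
enrolled at least `ℓ` stages earlier, and is meant for `ℓ < t`. -/
def delayHat (t ℓ : ℕ) (x : 𝒳) (a : Fin 2) (ω : Ω) : ℝ :=
  ((Finset.univ.filter fun i =>
      E.X i ω = x ∧ E.A i ω = a ∧ E.D i ω = (ℓ : ℕ∞) ∧ E.S i + ℓ ≤ t).card : ℝ) /
    ((Finset.univ.filter fun i => E.X i ω = x ∧ E.A i ω = a ∧ E.S i + ℓ ≤ t).card : ℝ)

/-- `ρ̂_t(d | x, a)` for all `d`, with conservative extrapolation for `d ≥ t`. -/
def rhoHat (t d : ℕ) (x : 𝒳) (a : Fin 2) (ω : Ω) : ℝ :=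
  conservative (fun d x a => ∑ ℓ ∈ Finset.range (d + 1), E.delayHat t ℓ x a ω) t d x a

/-- The empirical fully forward-looking objective at the end of stage `t`. -/
def empiricalObjective [Fintype 𝒳] (T t : ℕ) (ω : Ω) (u : ℕ → 𝒳 → ℝ) : ℝ :=
  forwardObjective T t (fun x => E.pHat t x ω) (fun x a => E.sigmaSqHat t x a ω) E.rHat
    (fun d x a => E.rhoHat t d x a ω) (fun ℓ x => E.e ℓ x ω) u

/-- The allocations come from the fully forward-looking design with conservative extrapolation:
equal allocation in stage `1`, and in stage `t + 1` the stage-`(t + 1)` component of an optimal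
plan (chosen by the tie-breaking rule) for the empirical objective at the end of stage `t`. -/
structure FollowsDesign [Fintype 𝒳] [MeasurableSpace Ω] (δ : ℝ) (T : ℕ) (P : Measure Ω) :
    Prop where
  initial : ∀ᵐ ω ∂P, ∀ x, E.e 1 x ω = 1 / 2
  step : ∀ t, 1 ≤ t → t < T → ∀ᵐ ω ∂P,
    ∃ u, IsOptimalPlan δ T t (E.empiricalObjective T t ω) u ∧ ∀ x, E.e (t + 1) x ω = u (t + 1) x

/-- Covariates and potential outcomes are i.i.d. across participants, with law `Q`. -/
structure IIDUnits [MeasurableSpace Ω] [MeasurableSpace 𝒳] (P : Measure Ω)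
    (Q : Measure (𝒳 × (Fin 2 → ℝ))) : Prop where
  measurable_W : ∀ i, Measurable (E.W i)
  indep : iIndepFun E.W P
  law : ∀ i, P.map (E.W i) = Q

/-- Sequential enrolment in stages `1, …, T`, treatment assignment and delay mechanism.

* `adapted`: the allocation of stage `t` is determined by the history `ℋ_{t-1}`.
* `enrolment`: a new participant's covariate and potential outcomes are independent of the history
  at enrolment.
* `treatment`: given the history, the covariate and the potential outcomes, arm `a` is assigned
  with probability `ê*_t(a | X_i)`.
* `delay`: given the history, covariate, potential outcomes and treatment, the delay is at most `d`
  with probability `ρ(d | X_i, A_i)`, whatever the stage; in particular it is independent of the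
  potential outcomes given `X_i, A_i, S_i`.
* `withinStage`: the participants of one stage are conditionally independent of each other given
  the history at the beginning of the stage (spelled out through conditional probabilities, so
  that `Ω` need not be a standard Borel space). -/
structure SequentialSampling [MeasurableSpace Ω] [MeasurableSpace 𝒳] (T : ℕ) (P : Measure Ω)
    (ρ : ℕ → 𝒳 → Fin 2 → ℝ) : Prop where
  stage_mem : ∀ i, E.S i ∈ Finset.Icc 1 T
  measurable_A : ∀ i, Measurable (E.A i)
  measurable_D : ∀ i, Measurable (E.D i)
  adapted : ∀ t ∈ Finset.Icc 1 T, ∀ x, Measurable[E.history (t - 1)] (E.e t x)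
  enrolment : ∀ i,
    Indep (MeasurableSpace.comap (E.W i) inferInstance) (E.history (E.S i - 1)) P
  treatment : ∀ i a,
    P⟦{ω | E.A i ω = a} |
        E.history (E.S i - 1) ⊔ MeasurableSpace.comap (E.W i) inferInstance⟧
      =ᵐ[P] fun ω => armProb (E.e (E.S i) (E.X i ω) ω) a
  delay : ∀ i (d : ℕ),
    P⟦{ω | E.D i ω ≤ (d : ℕ∞)} |
        E.history (E.S i - 1) ⊔ MeasurableSpace.comap (E.W i) inferInstance ⊔
          MeasurableSpace.comap (E.A i) inferInstance⟧
      =ᵐ[P] fun ω => ρ d (E.X i ω) (E.A i ω)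
  withinStage : ∀ t ∈ Finset.Icc 1 T, ∀ s : Finset (Fin E.N), (∀ i ∈ s, E.S i = t) →
    ∀ B : Fin E.N → Set (𝒳 × (Fin 2 → ℝ) × Fin 2 × ℕ∞), (∀ i ∈ s, MeasurableSet (B i)) →
      P⟦⋂ i ∈ s, E.Z i ⁻¹' B i | E.history (t - 1)⟧
        =ᵐ[P] ∏ i ∈ s, P⟦E.Z i ⁻¹' B i | E.history (t - 1)⟧

end Experiment

/-- Convergence in probability to a constant, for random variables that may live on different
probability spaces. -/
def TendstoInProb {Ω : ℕ → Type*} [∀ k, MeasurableSpace (Ω k)] (P : ∀ k, Measure (Ω k))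
    (f : ∀ k, Ω k → ℝ) (c : ℝ) : Prop :=
  ∀ ε : ℝ, 0 < ε → Tendsto (fun k => P k {ω | ε ≤ |f k ω - c|}) atTop (𝓝 0)

end

end DelayedCARA

open DelayedCARA

/-! The proof is a compactness argument combined with uniqueness of the population recursion. On the
disjoint union of the probability spaces, events of asymptotically full probability form a filter
`probFilter P`, and convergence in probability to a constant is convergence along it
(`tendstoInProb_iff`). Along any ultrafilter `U` finer than `probFilter P`, the allocations and the
chosen plans, all with values in `[δ, 1 - δ]`, have limits. These limits are not known in advance,
but they suffice for a law of large numbers: every estimator then converges along `U` to its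
population value. By `isOptimalPlan_of_tendsto` the limiting plans are optimal for the population
objective, so the limiting allocations form an `IsLimitAllocation`. This proves existence. By
`IsLimitAllocation.unique` all ultrafilters give the same limit, which proves convergence.

Uniqueness: the objective separates over covariate values and is strictly convex in the information
on each arm with nonzero variance. Two minimizers therefore share the marginal values `v a / B a ^
2` of information. If they differ in stage `t + 1`, that stage is balanced between the arms, as is
any stage where they differ in the opposite direction, so both stages have the same ratio of delay
probabilities. As these ratios differ at distinct delays, this can happen only among stages merged
by conservative extrapolation, and there the tie-breaking rule decides
(`IsCellMinimizer.le_of_tieBreaking`).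

Law of large numbers: given the history, cell indicators within a stage are independent with a
common conditional probability, so their sum deviates by order `√N` in mean. Density of simple
functions in `L¹` extends this to integrable functions of the outcomes
(`tendsto_lintegral_stageDev`). -/

namespace DelayedCARA

variable {𝒳 : Type*}

/-! ### Optimal plans for one covariate value -/

/-- The objective for one covariate value, for stages in `L` with weights `w a`, past information
`C a` and outcome variances `v a`. -/
noncomputable def cellObjective {ι : Type*} (L : Finset ι) (v C : Fin 2 → ℝ) (w : Fin 2 → ι → ℝ)
    (u : ι → ℝ) : ℝ :=
  v 1 / (C 1 + ∑ j ∈ L, w 1 j * u j) + v 0 / (C 0 + ∑ j ∈ L, w 0 j * (1 - u j))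

/-- First-order condition for moving information from one arm to the other. -/
lemma first_order_condition {v₁ v₀ w₁ w₀ B₁ B₀ η : ℝ} (hB₁ : 0 < B₁) (hB₀ : 0 < B₀) (hη : 0 < η)
    (h : ∀ s ∈ Set.Ioo 0 η, v₁ / B₁ + v₀ / B₀ ≤ v₁ / (B₁ + s * w₁) + v₀ / (B₀ - s * w₀)) :
    v₁ / B₁ ^ 2 * w₁ ≤ v₀ / B₀ ^ 2 * w₀ := by
  have l₁ : Tendsto (fun s : ℝ => B₁ + s * w₁) (𝓝[>] 0) (𝓝 B₁) := by
    have : Tendsto (fun s : ℝ => B₁ + s * w₁) (𝓝 0) (𝓝 (B₁ + 0 * w₁)) :=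
      (by fun_prop : Continuous fun s : ℝ => B₁ + s * w₁).tendsto 0
    simpa using this.mono_left nhdsWithin_le_nhds
  have l₀ : Tendsto (fun s : ℝ => B₀ - s * w₀) (𝓝[>] 0) (𝓝 B₀) := by
    have : Tendsto (fun s : ℝ => B₀ - s * w₀) (𝓝 0) (𝓝 (B₀ - 0 * w₀)) :=
      (by fun_prop : Continuous fun s : ℝ => B₀ - s * w₀).tendsto 0
    simpa using this.mono_left nhdsWithin_le_nhds
  have k₁ : Tendsto (fun s : ℝ => v₁ / (B₁ * (B₁ + s * w₁)) * w₁) (𝓝[>] 0)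
      (𝓝 (v₁ / (B₁ * B₁) * w₁)) :=
    (tendsto_const_nhds.div (tendsto_const_nhds.mul l₁) (by positivity)).mul_const _
  have k₀ : Tendsto (fun s : ℝ => v₀ / (B₀ * (B₀ - s * w₀)) * w₀) (𝓝[>] 0)
      (𝓝 (v₀ / (B₀ * B₀) * w₀)) :=
    (tendsto_const_nhds.div (tendsto_const_nhds.mul l₀) (by positivity)).mul_const _
  rw [pow_two, pow_two]
  refine le_of_tendsto_of_tendsto k₁ k₀ ?_
  filter_upwards [l₁.eventually (lt_mem_nhds hB₁), l₀.eventually (lt_mem_nhds hB₀),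
    Ioo_mem_nhdsGT hη] with s h₁ h₀ hs
  -- These expansions are exact, so the change of the objective is `s` times a difference of
  -- quotients; cancel `s`, then let it tend to `0`.
  have e₁ : v₁ / (B₁ + s * w₁) = v₁ / B₁ - s * (v₁ / (B₁ * (B₁ + s * w₁)) * w₁) := by
    field_simp
    ring
  have e₀ : v₀ / (B₀ - s * w₀) = v₀ / B₀ + s * (v₀ / (B₀ * (B₀ - s * w₀)) * w₀) := by
    field_simp
    ring
  have := h s hs
  rw [e₁, e₀] at this
  exact le_of_mul_le_mul_left (by linarith) hs.1

/-- Strict convexity of `v / B` as an identity: for `v ≠ 0` the gap vanishes only at `B = B'`, and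
`v = 0` needs no separate treatment. -/
lemma div_midpoint_gap {v B B' : ℝ} (hB : 0 < B) (hB' : 0 < B') :
    v / B + v / B' - 2 * (v / ((B + B') / 2)) = v * ((B - B') ^ 2 / (B * B' * (B + B'))) := by
  field_simp
  ring

section Cell

variable {ι : Type*} [DecidableEq ι] {L : Finset ι} {v C : Fin 2 → ℝ} {w : Fin 2 → ι → ℝ} {δ : ℝ}

lemma sum_mul_update (g : ι → ℝ) (u : ι → ℝ) {i : ι} (hi : i ∈ L) (s : ℝ) :
    ∑ j ∈ L, g j * Function.update u i (u i + s) j = ∑ j ∈ L, g j * u j + s * g i := by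
  have : ∀ j ∈ L, g j * Function.update u i (u i + s) j
      = g j * u j + if j = i then s * g i else 0 := by
    intro j _
    by_cases h : j = i
    · subst h; simp; ring
    · simp [h]
  rw [Finset.sum_congr rfl this, Finset.sum_add_distrib, Finset.sum_ite_eq' L i, if_pos hi]

lemma sum_mul_one_sub_update (g : ι → ℝ) (u : ι → ℝ) {i : ι} (hi : i ∈ L) (s : ℝ) :
    ∑ j ∈ L, g j * (1 - Function.update u i (u i + s) j)
      = ∑ j ∈ L, g j * (1 - u j) - s * g i := by
  have := sum_mul_update g u hi s
  simp only [mul_sub, mul_one, Finset.sum_sub_distrib]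
  linarith

/-- A minimizer of the one-cell objective over the box `[δ, 1 - δ]`. -/
structure IsCellMinimizer (L : Finset ι) (v C : Fin 2 → ℝ) (w : Fin 2 → ι → ℝ) (δ : ℝ)
    (u : ι → ℝ) : Prop where
  mem : ∀ j ∈ L, u j ∈ Set.Icc δ (1 - δ)
  le : ∀ u', (∀ j ∈ L, u' j ∈ Set.Icc δ (1 - δ)) →
    cellObjective L v C w u ≤ cellObjective L v C w u'

omit [DecidableEq ι] in
lemma info_one_pos (hδ : 0 < δ) (hC : ∀ a, 0 < C a) (hw : ∀ a, ∀ j ∈ L, 0 < w a j) {u : ι → ℝ}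
    (hu : ∀ j ∈ L, u j ∈ Set.Icc δ (1 - δ)) : 0 < C 1 + ∑ j ∈ L, w 1 j * u j :=
  add_pos_of_pos_of_nonneg (hC 1) (Finset.sum_nonneg fun j hj =>
    mul_nonneg (hw 1 j hj).le (hδ.le.trans (hu j hj).1))

omit [DecidableEq ι] in
lemma info_zero_pos (hδ : 0 < δ) (hC : ∀ a, 0 < C a) (hw : ∀ a, ∀ j ∈ L, 0 < w a j) {u : ι → ℝ}
    (hu : ∀ j ∈ L, u j ∈ Set.Icc δ (1 - δ)) : 0 < C 0 + ∑ j ∈ L, w 0 j * (1 - u j) :=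
  add_pos_of_pos_of_nonneg (hC 0) (Finset.sum_nonneg fun j hj =>
    mul_nonneg (hw 0 j hj).le (by linarith [(hu j hj).2]))

/-- Below the upper bound there is room to raise `u i` by a small `s`, which moves information from
arm `0` to arm `1`; minimality says that this cannot help. -/
lemma IsCellMinimizer.foc_up (hδ : 0 < δ) (hC : ∀ a, 0 < C a) (hw : ∀ a, ∀ j ∈ L, 0 < w a j)
    {u : ι → ℝ} (hu : IsCellMinimizer L v C w δ u) {i : ι} (hi : i ∈ L) (hlt : u i < 1 - δ) :
    v 1 / (C 1 + ∑ j ∈ L, w 1 j * u j) ^ 2 * w 1 i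
      ≤ v 0 / (C 0 + ∑ j ∈ L, w 0 j * (1 - u j)) ^ 2 * w 0 i := by
  refine first_order_condition (info_one_pos hδ hC hw hu.mem) (info_zero_pos hδ hC hw hu.mem)
    (sub_pos.2 hlt) fun s hs => ?_
  have := hu.le (Function.update u i (u i + s)) fun j hj => by
    by_cases h : j = i
    · subst h
      simp only [Function.update_self]
      exact ⟨by linarith [(hu.mem j hj).1, hs.1], by linarith [hs.2]⟩
    · simpa [h] using hu.mem j hj
  simpa only [cellObjective, sum_mul_update _ _ hi, sum_mul_one_sub_update _ _ hi, ← add_assoc,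
    ← add_sub_assoc] using this

/-- Mirror image of `foc_up`: the perturbation is `-s` and the arms exchange roles. -/
lemma IsCellMinimizer.foc_down (hδ : 0 < δ) (hC : ∀ a, 0 < C a) (hw : ∀ a, ∀ j ∈ L, 0 < w a j)
    {u : ι → ℝ} (hu : IsCellMinimizer L v C w δ u) {i : ι} (hi : i ∈ L) (hlt : δ < u i) :
    v 0 / (C 0 + ∑ j ∈ L, w 0 j * (1 - u j)) ^ 2 * w 0 i
      ≤ v 1 / (C 1 + ∑ j ∈ L, w 1 j * u j) ^ 2 * w 1 i := by
  refine first_order_condition (info_zero_pos hδ hC hw hu.mem) (info_one_pos hδ hC hw hu.mem)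
    (sub_pos.2 hlt) fun s hs => ?_
  have := hu.le (Function.update u i (u i + -s)) fun j hj => by
    by_cases h : j = i
    · subst h
      simp only [Function.update_self]
      exact ⟨by linarith [hs.2], by linarith [(hu.mem j hj).2, hs.1]⟩
    · simpa [h] using hu.mem j hj
  simp only [cellObjective, sum_mul_update _ _ hi, sum_mul_one_sub_update _ _ hi] at this
  convert this using 1
  · ring
  · rw [add_comm]
    congr 2 <;> ring

omit [DecidableEq ι] in
/-- By strict convexity, the information on an arm with nonzero variance is the same under all
minimizers. -/
lemma IsCellMinimizer.info_eq (hδ : 0 < δ) (hC : ∀ a, 0 < C a) (hw : ∀ a, ∀ j ∈ L, 0 < w a j)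
    (hv : ∀ a, 0 ≤ v a) {u u' : ι → ℝ}
    (hu : IsCellMinimizer L v C w δ u) (hu' : IsCellMinimizer L v C w δ u') :
    (v 1 ≠ 0 → ∑ j ∈ L, w 1 j * u j = ∑ j ∈ L, w 1 j * u' j) ∧
    (v 0 ≠ 0 → ∑ j ∈ L, w 0 j * (1 - u j) = ∑ j ∈ L, w 0 j * (1 - u' j)) := by
  have b₁ := info_one_pos hδ hC hw hu.mem
  have b₀ := info_zero_pos hδ hC hw hu.mem
  have b₁' := info_one_pos hδ hC hw hu'.mem
  have b₀' := info_zero_pos hδ hC hw hu'.mem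
  have hm : ∀ j ∈ L, (fun j => (u j + u' j) / 2) j ∈ Set.Icc δ (1 - δ) := fun j hj =>
    ⟨by linarith [(hu.mem j hj).1, (hu'.mem j hj).1], by linarith [(hu.mem j hj).2, (hu'.mem j hj).2]⟩
  have e₁ : C 1 + ∑ j ∈ L, w 1 j * ((u j + u' j) / 2)
      = ((C 1 + ∑ j ∈ L, w 1 j * u j) + (C 1 + ∑ j ∈ L, w 1 j * u' j)) / 2 := by
    have : ∑ j ∈ L, w 1 j * ((u j + u' j) / 2)
        = (∑ j ∈ L, w 1 j * u j + ∑ j ∈ L, w 1 j * u' j) / 2 := by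
      rw [← Finset.sum_add_distrib, Finset.sum_div]
      exact Finset.sum_congr rfl fun j _ => by ring
    rw [this]; ring
  have e₀ : C 0 + ∑ j ∈ L, w 0 j * (1 - (u j + u' j) / 2)
      = ((C 0 + ∑ j ∈ L, w 0 j * (1 - u j)) + (C 0 + ∑ j ∈ L, w 0 j * (1 - u' j))) / 2 := by
    have : ∑ j ∈ L, w 0 j * (1 - (u j + u' j) / 2)
        = (∑ j ∈ L, w 0 j * (1 - u j) + ∑ j ∈ L, w 0 j * (1 - u' j)) / 2 := by
      rw [← Finset.sum_add_distrib, Finset.sum_div]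
      exact Finset.sum_congr rfl fun j _ => by ring
    rw [this]; ring
  have h := hu.le _ hm
  have h' := hu'.le _ hm
  simp only [cellObjective, e₁, e₀] at h h'
  have g₁ := div_midpoint_gap (v := v 1) b₁ b₁'
  have g₀ := div_midpoint_gap (v := v 0) b₀ b₀'
  have n₁ : 0 ≤ v 1 * ((C 1 + ∑ j ∈ L, w 1 j * u j - (C 1 + ∑ j ∈ L, w 1 j * u' j)) ^ 2 /
      ((C 1 + ∑ j ∈ L, w 1 j * u j) * (C 1 + ∑ j ∈ L, w 1 j * u' j) *
        (C 1 + ∑ j ∈ L, w 1 j * u j + (C 1 + ∑ j ∈ L, w 1 j * u' j)))) :=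
    mul_nonneg (hv 1) (by positivity)
  have n₀ : 0 ≤ v 0 * ((C 0 + ∑ j ∈ L, w 0 j * (1 - u j) -
      (C 0 + ∑ j ∈ L, w 0 j * (1 - u' j))) ^ 2 /
      ((C 0 + ∑ j ∈ L, w 0 j * (1 - u j)) * (C 0 + ∑ j ∈ L, w 0 j * (1 - u' j)) *
        (C 0 + ∑ j ∈ L, w 0 j * (1 - u j) + (C 0 + ∑ j ∈ L, w 0 j * (1 - u' j))))) :=
    mul_nonneg (hv 0) (by positivity)
  -- Summing `h` and `h'`, the two midpoint gaps add up to at most `0`; both are nonnegative, so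
  -- each vanishes.
  constructor
  · intro hne
    have z := le_antisymm (by linarith) n₁
    rw [mul_eq_zero, or_iff_right hne, div_eq_zero_iff, or_iff_left (by positivity)] at z
    linarith [pow_eq_zero_iff (two_ne_zero) |>.1 z]
  · intro hne
    have z := le_antisymm (by linarith) n₀
    rw [mul_eq_zero, or_iff_right hne, div_eq_zero_iff, or_iff_left (by positivity)] at z
    linarith [pow_eq_zero_iff (two_ne_zero) |>.1 z]

/-- Under the tie-breaking rule, minimizers agree in the coordinate `i`. -/
lemma IsCellMinimizer.le_of_tieBreaking (hδ : 0 < δ) (hC : ∀ a, 0 < C a)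
    (hw : ∀ a, ∀ j ∈ L, 0 < w a j) (hv : ∀ a, 0 ≤ v a) (hv0 : v 0 ≠ 0 ∨ v 1 ≠ 0) {u u' : ι → ℝ}
    (hu : IsCellMinimizer L v C w δ u) (hu' : IsCellMinimizer L v C w δ u') {i : ι} (hi : i ∈ L)
    (htie : ∀ j ∈ L, j ≠ i → w 1 j / w 0 j = w 1 i / w 0 i → δ < u j → u i = 1 - δ) :
    u' i ≤ u i := by
  by_contra! hlt
  obtain ⟨I₁, I₀⟩ := hu.info_eq hδ hC hw hv hu'
  have b₁ := info_one_pos hδ hC hw hu.mem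
  have b₀ := info_zero_pos hδ hC hw hu.mem
  -- The marginal values `l₁`, `l₀` are the same for `u` and `u'`: by `info_eq` if the variance is
  -- nonzero, trivially if it is zero.
  obtain ⟨l₁, hl₁⟩ : ∃ l, l = v 1 / (C 1 + ∑ j ∈ L, w 1 j * u j) ^ 2 := ⟨_, rfl⟩
  obtain ⟨l₀, hl₀⟩ : ∃ l, l = v 0 / (C 0 + ∑ j ∈ L, w 0 j * (1 - u j)) ^ 2 := ⟨_, rfl⟩
  have hl₁' : l₁ = v 1 / (C 1 + ∑ j ∈ L, w 1 j * u' j) ^ 2 := by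
    by_cases h : v 1 = 0
    · rw [hl₁, h, zero_div, zero_div]
    · rw [hl₁, I₁ h]
  have hl₀' : l₀ = v 0 / (C 0 + ∑ j ∈ L, w 0 j * (1 - u' j)) ^ 2 := by
    by_cases h : v 0 = 0
    · rw [hl₀, h, zero_div, zero_div]
    · rw [hl₀, I₀ h]
  have up : ∀ j ∈ L, u j < 1 - δ → l₁ * w 1 j ≤ l₀ * w 0 j := fun j hj h => by
    rw [hl₁, hl₀]; exact hu.foc_up hδ hC hw hj h
  have up' : ∀ j ∈ L, u' j < 1 - δ → l₁ * w 1 j ≤ l₀ * w 0 j := fun j hj h => by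
    rw [hl₁', hl₀']; exact hu'.foc_up hδ hC hw hj h
  have down : ∀ j ∈ L, δ < u j → l₀ * w 0 j ≤ l₁ * w 1 j := fun j hj h => by
    rw [hl₁, hl₀]; exact hu.foc_down hδ hC hw hj h
  have down' : ∀ j ∈ L, δ < u' j → l₀ * w 0 j ≤ l₁ * w 1 j := fun j hj h => by
    rw [hl₁', hl₀']; exact hu'.foc_down hδ hC hw hj h
  have hui : u i < 1 - δ := hlt.trans_le (hu'.mem i hi).2
  -- In coordinate `i`, `u` can move up and `u'` can move down, so both first-order conditions hold
  -- there.
  have heq : l₁ * w 1 i = l₀ * w 0 i :=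
    le_antisymm (up i hi hui) (down' i hi ((hu.mem i hi).1.trans_lt hlt))
  have w₁ := hw 1 i hi
  have w₀ := hw 0 i hi
  have hv1 : v 1 ≠ 0 := by
    intro h
    rw [h, zero_div] at hl₁
    rw [hl₁, zero_mul, zero_eq_mul, or_iff_left w₀.ne', hl₀, div_eq_zero_iff,
      or_iff_left (by positivity)] at heq
    exact hv0.elim (fun h' => h' heq) fun h' => h' h
  have pos₁ : 0 < l₁ := by
    rw [hl₁]
    exact div_pos ((hv 1).lt_of_ne' hv1) (by positivity)
  have pos₀ : 0 < l₀ := by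
    have := mul_pos pos₁ w₁
    rw [heq] at this
    exact pos_of_mul_pos_left this w₀.le
  -- A coordinate with `u' j < u j` would be balanced too, hence have the same weight ratio as `i`;
  -- then `htie` would put `u i` at the upper bound, which `u i < u' i` excludes. So `u ≤ u'`
  -- everywhere, strictly at `i`, against equal information on arm `1`.
  have key : ∀ j ∈ L, u j ≤ u' j := by
    intro j hj
    have w₁' := hw 1 j hj
    have w₀' := hw 0 j hj
    by_cases hji : j = i
    · rw [hji]; exact hlt.le
    by_contra! hc
    have e : l₁ * w 1 j = l₀ * w 0 j :=
      le_antisymm (up' j hj (hc.trans_le (hu.mem j hj).2))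
        (down j hj ((hu'.mem j hj).1.trans_lt hc))
    refine hui.ne (htie j hj hji ?_ ((hu'.mem j hj).1.trans_lt hc))
    rw [div_eq_div_iff w₀'.ne' w₀.ne']
    refine mul_left_cancel₀ (mul_pos pos₁ pos₀).ne' ?_
    linear_combination l₀ * w 0 i * e - l₀ * w 0 j * heq
  have : ∑ j ∈ L, w 1 j * u j < ∑ j ∈ L, w 1 j * u' j :=
    Finset.sum_lt_sum (fun j hj => mul_le_mul_of_nonneg_left (key j hj) (hw 1 j hj).le)
      ⟨i, hi, mul_lt_mul_of_pos_left hlt w₁⟩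
  exact this.ne (I₁ hv1)

end Cell

/-! ### Uniqueness of the limit allocation -/

lemma conservative_eq (ρ : ℕ → 𝒳 → Fin 2 → ℝ) {t : ℕ} (ht : 1 ≤ t) (d : ℕ) (x : 𝒳) (a : Fin 2) :
    conservative ρ t d x a = ρ (min d (t - 1)) x a := by
  unfold conservative
  split_ifs with h
  · rw [min_eq_left (by omega)]
  · rw [min_eq_right (by omega)]

/-- The information on the arms, for covariate value `x`, collected in the first `t` stages. -/
def pastInfo {𝒳 : Type*} (T t : ℕ) (r : ℕ → ℝ) (ρ : ℕ → 𝒳 → Fin 2 → ℝ) (past : ℕ → 𝒳 → ℝ)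
    (x : 𝒳) (a : Fin 2) : ℝ :=
  ∑ ℓ ∈ Finset.Icc 1 t, r ℓ * ρ (T - ℓ) x a * armProb (past ℓ x) a

lemma forwardObjective_eq [Fintype 𝒳] (T t : ℕ) (p : 𝒳 → ℝ) (v : 𝒳 → Fin 2 → ℝ)
    (r : ℕ → ℝ) (ρ : ℕ → 𝒳 → Fin 2 → ℝ) (past : ℕ → 𝒳 → ℝ) (u : ℕ → 𝒳 → ℝ) :
    forwardObjective T t p v r ρ past u = ∑ x, p x * cellObjective (Finset.Icc (t + 1) T) (v x)
      (pastInfo T t r ρ past x) (fun a ℓ => r ℓ * ρ (T - ℓ) x a) (fun ℓ => u ℓ x) := by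
  simp [forwardObjective, cellObjective, pastInfo, armProb]

/-- The objective and the box constraints separate over covariate values: alter the plan at `x`
only, cancel the other summands and divide by `p x > 0`. -/
lemma IsOptimalPlan.isCellMinimizer [Fintype 𝒳] {δ : ℝ} {T t : ℕ} {p : 𝒳 → ℝ}
    {v : 𝒳 → Fin 2 → ℝ} {r : ℕ → ℝ} {ρ : ℕ → 𝒳 → Fin 2 → ℝ} {past u : ℕ → 𝒳 → ℝ}
    (hu : IsOptimalPlan δ T t (forwardObjective T t p v r ρ past) u) {x : 𝒳} (hp : 0 < p x) :
    IsCellMinimizer (Finset.Icc (t + 1) T) (v x) (pastInfo T t r ρ past x)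
      (fun a ℓ => r ℓ * ρ (T - ℓ) x a) δ (fun ℓ => u ℓ x) := by
  classical
  refine ⟨fun ℓ hℓ => hu.feasible ℓ hℓ x, fun u' hu' => ?_⟩
  have h := hu.minimal (fun ℓ y => if y = x then u' ℓ else u ℓ y) fun ℓ hℓ y => by
    by_cases hy : y = x
    · simpa [hy] using hu' ℓ hℓ
    · simpa [hy] using hu.feasible ℓ hℓ y
  rw [forwardObjective_eq, forwardObjective_eq, ← Finset.add_sum_erase _ _ (Finset.mem_univ x),
    ← Finset.add_sum_erase _ _ (Finset.mem_univ x)] at h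
  have e : ∀ y ∈ Finset.univ.erase x, p y * cellObjective (Finset.Icc (t + 1) T) (v y)
      (pastInfo T t r ρ past y) (fun a ℓ => r ℓ * ρ (T - ℓ) y a)
        (fun ℓ => if y = x then u' ℓ else u ℓ y) =
      p y * cellObjective (Finset.Icc (t + 1) T) (v y)
      (pastInfo T t r ρ past y) (fun a ℓ => r ℓ * ρ (T - ℓ) y a) (fun ℓ => u ℓ y) := by
    intro y hy
    simp [Finset.ne_of_mem_erase hy]
  rw [Finset.sum_congr rfl e] at h
  simp only [if_true] at h
  exact le_of_mul_le_mul_left (le_of_add_le_add_right h) hp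

/-- The standing conditions on the population quantities in the allocation recursion. -/
structure PopulationConditions (T : ℕ) (p : 𝒳 → ℝ) (v : 𝒳 → Fin 2 → ℝ) (r : ℕ → ℝ)
    (ρ : ℕ → 𝒳 → Fin 2 → ℝ) : Prop where
  weight_pos : ∀ x, 0 < p x
  variance_nonneg : ∀ x a, 0 ≤ v x a
  variance_ne : ∀ x, v x 0 ≠ 0 ∨ v x 1 ≠ 0
  share_pos : ∀ t ∈ Finset.Icc 1 T, 0 < r t
  delay_pos : ∀ d x a, 0 < ρ d x a
  ratio_ne : ∀ x, ∀ d < T, ∀ d' < T, d ≠ d' → ρ d x 1 / ρ d x 0 ≠ ρ d' x 1 / ρ d' x 0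

variable {T t : ℕ} {δ : ℝ} {p : 𝒳 → ℝ} {v : 𝒳 → Fin 2 → ℝ} {r : ℕ → ℝ} {ρ : ℕ → 𝒳 → Fin 2 → ℝ}

lemma armProb_pos {e : ℝ} (h0 : 0 < e) (h1 : e < 1) (a : Fin 2) : 0 < armProb e a := by
  unfold armProb
  split_ifs <;> linarith

lemma pastInfo_pos (hr : ∀ t ∈ Finset.Icc 1 T, 0 < r t) (hρ : ∀ d x a, 0 < ρ d x a)
    (ht : 1 ≤ t) (htT : t < T) {past : ℕ → 𝒳 → ℝ}
    (hpast : ∀ ℓ ∈ Finset.Icc 1 t, ∀ x, past ℓ x ∈ Set.Ioo 0 1) (x : 𝒳) (a : Fin 2) :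
    0 < pastInfo T t r ρ past x a := by
  refine Finset.sum_pos (fun ℓ hℓ => ?_) ⟨1, by simp [ht]⟩
  have := hr ℓ (Finset.Icc_subset_Icc_right htT.le hℓ)
  have := hρ (T - ℓ) x a
  have := armProb_pos (hpast ℓ hℓ x).1 (hpast ℓ hℓ x).2 a
  positivity

/-- Only the plan `u` has to break ties correctly; of `u'` only minimality matters. Applying the
bound both ways gives uniqueness. -/
lemma IsOptimalPlan.le_of_population [Fintype 𝒳] (h : PopulationConditions T p v r ρ)
    (hδ : 0 < δ) (ht : 1 ≤ t) (htT : t < T) {past u u' : ℕ → 𝒳 → ℝ}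
    (hpast : ∀ ℓ ∈ Finset.Icc 1 t, ∀ x, past ℓ x ∈ Set.Ioo 0 1)
    (hu : IsOptimalPlan δ T t (forwardObjective T t p v r (conservative ρ t) past) u)
    (hu' : IsOptimalPlan δ T t (forwardObjective T t p v r (conservative ρ t) past) u') (x : 𝒳) :
    u' (t + 1) x ≤ u (t + 1) x := by
  have hc : ∀ d x a, 0 < conservative ρ t d x a := fun d x a => by
    rw [conservative_eq ρ ht]; exact h.delay_pos _ _ _
  have hsh : ∀ ℓ ∈ Finset.Icc (t + 1) T, 0 < r ℓ := fun ℓ hℓ =>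
    h.share_pos ℓ (Finset.Icc_subset_Icc_left (by omega) hℓ)
  refine (hu.isCellMinimizer (h.weight_pos x)).le_of_tieBreaking hδ
    (pastInfo_pos h.share_pos hc ht htT hpast x) (fun a ℓ hℓ => mul_pos (hsh ℓ hℓ) (hc _ _ _))
    (h.variance_nonneg x) (h.variance_ne x) (hu'.isCellMinimizer (h.weight_pos x))
    (by simp; omega) fun ℓ hℓ hne hratio hlt => ?_
  have hi : t + 1 ∈ Finset.Icc (t + 1) T := by simp; omega
  rw [mul_div_mul_left _ _ (hsh ℓ hℓ).ne', mul_div_mul_left _ _ (hsh _ hi).ne'] at hratio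
  simp only [conservative_eq ρ ht] at hratio
  simp only [Finset.mem_Icc] at hℓ
  -- Equal ratios force equal truncated delays. Since `ℓ > t + 1`, both delays must be cut off at `t
  -- - 1`, which means `ℓ ≤ T - t + 1` and `2 * t ≤ T`: exactly the range of the tie-breaking rule.
  have := not_ne_iff.1 (mt (h.ratio_ne x (min (T - ℓ) (t - 1)) (by omega)
    (min (T - (t + 1)) (t - 1)) (by omega)) (not_not.2 hratio))
  exact hu.tieBreaking (by omega) x ⟨ℓ, by simp; omega, hlt⟩

lemma IsLimitAllocation.mem_Icc [Fintype 𝒳] (hδ' : δ < 1 / 2) {e : ℕ → 𝒳 → ℝ}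
    (he : IsLimitAllocation δ T p v r ρ e) (ht : t ∈ Finset.Icc 1 T) (x : 𝒳) :
    e t x ∈ Set.Icc δ (1 - δ) := by
  simp only [Finset.mem_Icc] at ht
  obtain rfl | h1 := eq_or_lt_of_le ht.1
  · rw [he.initial]; constructor <;> linarith
  · obtain ⟨s, rfl⟩ : ∃ s, t = s + 1 := ⟨t - 1, by omega⟩
    obtain ⟨u, hu, hue⟩ := he.step s (by omega) (by omega)
    rw [hue]
    exact hu.feasible _ (by simp; omega) x

lemma forwardObjective_congr_past [Fintype 𝒳] {past past' : ℕ → 𝒳 → ℝ}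
    (h : ∀ ℓ ∈ Finset.Icc 1 t, ∀ x, past ℓ x = past' ℓ x) :
    forwardObjective T t p v r ρ past = forwardObjective T t p v r ρ past' := by
  have : pastInfo T t r ρ past = pastInfo T t r ρ past' := by
    funext x a
    exact Finset.sum_congr rfl fun ℓ hℓ => by rw [h ℓ hℓ x]
  funext u
  rw [forwardObjective_eq, forwardObjective_eq, this]

/-- Induction over stages: once the earlier allocations agree, both next components come from
optimal plans for one and the same objective. -/
theorem IsLimitAllocation.unique [Fintype 𝒳] (h : PopulationConditions T p v r ρ)
    (hδ : 0 < δ) (hδ' : δ < 1 / 2) {e e' : ℕ → 𝒳 → ℝ} (he : IsLimitAllocation δ T p v r ρ e)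
    (he' : IsLimitAllocation δ T p v r ρ e') :
    ∀ t ∈ Finset.Icc 1 T, ∀ x, e t x = e' t x := by
  intro t
  induction t using Nat.strong_induction_on with
  | _ t ih =>
    intro ht x
    have ht' := Finset.mem_Icc.1 ht
    obtain rfl | h1 := eq_or_lt_of_le ht'.1
    · rw [he.initial, he'.initial]
    · obtain ⟨s, rfl⟩ : ∃ s, t = s + 1 := ⟨t - 1, by omega⟩
      obtain ⟨u, hu, hue⟩ := he.step s (by omega) (by omega)
      obtain ⟨u', hu', hue'⟩ := he'.step s (by omega) (by omega)
      have hmem : ∀ ℓ ∈ Finset.Icc 1 s, ℓ < s + 1 ∧ ℓ ∈ Finset.Icc 1 T := fun ℓ hℓ => by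
        simp only [Finset.mem_Icc] at hℓ ⊢; omega
      rw [forwardObjective_congr_past (fun ℓ hℓ => ih ℓ (hmem ℓ hℓ).1 (hmem ℓ hℓ).2)] at hu
      have hpast : ∀ ℓ ∈ Finset.Icc 1 s, ∀ x, e' ℓ x ∈ Set.Ioo 0 1 := fun ℓ hℓ x => by
        have := he'.mem_Icc hδ' (hmem ℓ hℓ).2 x
        exact ⟨by linarith [this.1], by linarith [this.2]⟩
      rw [hue, hue']
      exact le_antisymm (hu'.le_of_population h hδ (by omega) (by omega) hpast hu x)
        (hu.le_of_population h hδ (by omega) (by omega) hpast hu' x)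

/-! ### Limits of optimal plans -/

lemma continuous_armProb (a : Fin 2) : Continuous fun e => armProb e a := by
  unfold armProb
  split_ifs <;> fun_prop

/-- A limit of optimal plans is optimal for the limiting objective. -/
theorem isOptimalPlan_of_tendsto [Fintype 𝒳] {α : Type*} {U : Filter α} [U.NeBot]
    {p' : α → 𝒳 → ℝ} {v' : α → 𝒳 → Fin 2 → ℝ} {r' : α → ℕ → ℝ} {ρ' : α → ℕ → 𝒳 → Fin 2 → ℝ}
    {past' u' : α → ℕ → 𝒳 → ℝ} {past u : ℕ → 𝒳 → ℝ} (hδ : 0 < δ)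
    (ht : 1 ≤ t) (htT : t < T) (hr : ∀ t ∈ Finset.Icc 1 T, 0 < r t) (hρ : ∀ d x a, 0 < ρ d x a)
    (hpast : ∀ ℓ ∈ Finset.Icc 1 t, ∀ x, past ℓ x ∈ Set.Ioo 0 1)
    (lp : ∀ x, Tendsto (fun k => p' k x) U (𝓝 (p x)))
    (lv : ∀ x a, Tendsto (fun k => v' k x a) U (𝓝 (v x a)))
    (lr : ∀ ℓ ∈ Finset.Icc 1 T, Tendsto (fun k => r' k ℓ) U (𝓝 (r ℓ)))
    (lρ : ∀ d x a, Tendsto (fun k => ρ' k d x a) U (𝓝 (ρ d x a)))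
    (lpast : ∀ ℓ ∈ Finset.Icc 1 t, ∀ x, Tendsto (fun k => past' k ℓ x) U (𝓝 (past ℓ x)))
    (lu : ∀ ℓ ∈ Finset.Icc (t + 1) T, ∀ x, Tendsto (fun k => u' k ℓ x) U (𝓝 (u ℓ x)))
    (hopt : ∀ᶠ k in U, IsOptimalPlan δ T t
      (forwardObjective T t (p' k) (v' k) (r' k) (ρ' k) (past' k)) (u' k)) :
    IsOptimalPlan δ T t (forwardObjective T t p v r ρ past) u := by
  have hsub : Finset.Icc 1 t ⊆ Finset.Icc 1 T := Finset.Icc_subset_Icc_right htT.le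
  have hsub' : Finset.Icc (t + 1) T ⊆ Finset.Icc 1 T := Finset.Icc_subset_Icc_left (by omega)
  have hfeas : FeasiblePlan δ T t u := fun ℓ hℓ x =>
    isClosed_Icc.mem_of_tendsto (lu ℓ hℓ x) (hopt.mono fun k hk => hk.feasible ℓ hℓ x)
  have linfo : ∀ x a, Tendsto (fun k => pastInfo T t (r' k) (ρ' k) (past' k) x a) U
      (𝓝 (pastInfo T t r ρ past x a)) := fun x a =>
    tendsto_finsetSum _ fun ℓ hℓ => ((lr ℓ (hsub hℓ)).mul (lρ _ x a)).mul
      (((continuous_armProb a).tendsto _).comp (lpast ℓ hℓ x))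
  have hobj : ∀ {z' : α → ℕ → 𝒳 → ℝ} {z : ℕ → 𝒳 → ℝ}, FeasiblePlan δ T t z →
      (∀ ℓ ∈ Finset.Icc (t + 1) T, ∀ x, Tendsto (fun k => z' k ℓ x) U (𝓝 (z ℓ x))) →
      Tendsto (fun k => forwardObjective T t (p' k) (v' k) (r' k) (ρ' k) (past' k) (z' k)) U
        (𝓝 (forwardObjective T t p v r ρ past z)) := by
    intro z' z hz lz
    simp only [forwardObjective_eq]
    -- The past stages alone keep the limiting denominators positive, so division is continuous at
    -- the limit.
    have hC := pastInfo_pos hr hρ ht htT hpast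
    have hw : ∀ x a, ∀ ℓ ∈ Finset.Icc (t + 1) T, 0 < r ℓ * ρ (T - ℓ) x a :=
      fun x a ℓ hℓ => mul_pos (hr ℓ (hsub' hℓ)) (hρ _ _ _)
    refine tendsto_finsetSum _ fun x _ => (lp x).mul (((lv x 1).div ((linfo x 1).add ?_)
      ?_).add ((lv x 0).div ((linfo x 0).add ?_) ?_))
    · exact tendsto_finsetSum _ fun ℓ hℓ => ((lr ℓ (hsub' hℓ)).mul (lρ _ x 1)).mul (lz ℓ hℓ x)
    · exact (info_one_pos hδ (hC x) (hw x) fun ℓ hℓ => hz ℓ hℓ x).ne'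
    · exact tendsto_finsetSum _ fun ℓ hℓ => ((lr ℓ (hsub' hℓ)).mul (lρ _ x 0)).mul
        (tendsto_const_nhds.sub (lz ℓ hℓ x))
    · exact (info_zero_pos hδ (hC x) (hw x) fun ℓ hℓ => hz ℓ hℓ x).ne'
  refine ⟨hfeas, fun z hz => ?_, fun h2t x ⟨ℓ, hℓ, hlt⟩ => ?_⟩
  · exact le_of_tendsto_of_tendsto (hobj hfeas lu) (hobj hz fun _ _ _ => tendsto_const_nhds)
      (hopt.mono fun k hk => hk.minimal z hz)
  -- The tie-breaking rule survives limits because its premise `δ < u ℓ x` is open and its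
  -- conclusion is closed.
  · have hℓ' : ℓ ∈ Finset.Icc (t + 1) T := by simp only [Finset.mem_Icc] at hℓ ⊢; omega
    have hev : ∀ᶠ k in U, u' k (t + 1) x = 1 - δ := by
      filter_upwards [hopt, (lu ℓ hℓ' x).eventually (lt_mem_nhds hlt)] with k hk hk'
      exact hk.tieBreaking h2t x ⟨ℓ, hℓ, hk'⟩
    exact tendsto_nhds_unique ((lu (t + 1) (by simp; omega) x).congr' hev)
      tendsto_const_nhds

/-! ### Second moments of conditionally uncorrelated counts -/

section Counts

variable {Ω : Type*} {m m0 : MeasurableSpace Ω} {P : Measure Ω} [IsProbabilityMeasure P]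

/-- If events have the same conditional probability `ξ` given `m` and are conditionally pairwise
independent, the deviation of the number of events from its conditional mean has second moment at
most the number of events. -/
lemma integral_sq_sum_indicator_sub_le {ι : Type*} (s : Finset ι) (hm : m ≤ m0) {B : ι → Set Ω}
    (hB : ∀ i ∈ s, MeasurableSet (B i)) {ξ : Ω → ℝ} (hξ : StronglyMeasurable[m] ξ) {K : ℝ}
    (hK : ∀ᵐ ω ∂P, ‖ξ ω‖ ≤ K) (h1 : ∀ i ∈ s, P⟦B i | m⟧ =ᵐ[P] ξ)
    (h2 : ∀ i ∈ s, ∀ j ∈ s, i ≠ j → P⟦B i ∩ B j | m⟧ =ᵐ[P] ξ * ξ) :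
    Integrable (fun ω => (∑ i ∈ s, ((B i).indicator (fun _ => (1 : ℝ)) ω - ξ ω)) ^ 2) P ∧
    ∫ ω, (∑ i ∈ s, ((B i).indicator (fun _ => (1 : ℝ)) ω - ξ ω)) ^ 2 ∂P ≤ s.card := by
  have iξ : Integrable ξ P := Integrable.of_bound (hξ.mono hm).aestronglyMeasurable K hK
  have iξξ : Integrable (ξ * ξ) P := iξ.bdd_mul (hξ.mono hm).aestronglyMeasurable hK
  have iB : ∀ A : Set Ω, MeasurableSet A → Integrable (A.indicator fun _ => (1 : ℝ)) P :=
    fun A hA => (integrable_const 1).indicator hA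
  have iξB : ∀ i ∈ s, Integrable (ξ * (B i).indicator fun _ => (1 : ℝ)) P :=
    fun i hi => (iB _ (hB i hi)).bdd_mul (hξ.mono hm).aestronglyMeasurable hK
  have eξB : ∀ i ∈ s, ∫ ω, (ξ * (B i).indicator fun _ => (1 : ℝ)) ω ∂P
      = ∫ ω, (ξ * ξ) ω ∂P := fun i hi => by
    rw [← integral_condExp hm]
    refine integral_congr_ae ?_
    filter_upwards [condExp_mul_of_stronglyMeasurable_left hξ (iξB i hi) (iB _ (hB i hi)),
      h1 i hi] with ω e1 e2
    rw [e1, Pi.mul_apply, Pi.mul_apply, e2]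
  have expand : ∀ i j ω, ((B i).indicator (fun _ => (1 : ℝ)) ω - ξ ω) *
      ((B j).indicator (fun _ => (1 : ℝ)) ω - ξ ω) = (B i ∩ B j).indicator (fun _ => (1 : ℝ)) ω
        - (ξ * (B i).indicator fun _ => (1 : ℝ)) ω - (ξ * (B j).indicator fun _ => (1 : ℝ)) ω
        + (ξ * ξ) ω := by
    intro i j ω
    simp only [Pi.mul_apply]
    by_cases hi : ω ∈ B i <;> by_cases hj : ω ∈ B j <;> simp [hi, hj] <;> ring
  have iprod : ∀ i ∈ s, ∀ j ∈ s, Integrable (fun ω => ((B i).indicator (fun _ => (1 : ℝ)) ω - ξ ω) *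
      ((B j).indicator (fun _ => (1 : ℝ)) ω - ξ ω)) P := fun i hi j hj => by
    simp_rw [expand]
    exact (((iB _ ((hB i hi).inter (hB j hj))).sub (iξB i hi)).sub (iξB j hj)).add iξξ
  have eprod : ∀ i ∈ s, ∀ j ∈ s, ∫ ω, ((B i).indicator (fun _ => (1 : ℝ)) ω - ξ ω) *
      ((B j).indicator (fun _ => (1 : ℝ)) ω - ξ ω) ∂P
      = P.real (B i ∩ B j) - ∫ ω, (ξ * ξ) ω ∂P := fun i hi j hj => by
    have hij := (hB i hi).inter (hB j hj)
    simp_rw [expand]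
    change ∫ ω, ((B i ∩ B j).indicator (fun _ => (1 : ℝ)) - ξ * (B i).indicator (fun _ => (1 : ℝ))
      - ξ * (B j).indicator (fun _ => (1 : ℝ)) + ξ * ξ) ω ∂P = _
    rw [integral_add' (((iB _ hij).sub (iξB i hi)).sub (iξB j hj)) iξξ,
      integral_sub' ((iB _ hij).sub (iξB i hi)) (iξB j hj), integral_sub' (iB _ hij) (iξB i hi),
      eξB i hi, eξB j hj, integral_indicator_const _ hij, smul_eq_mul, mul_one]
    ring
  simp_rw [pow_two, Finset.sum_mul_sum]
  refine ⟨integrable_finsetSum _ fun i hi => integrable_finsetSum _ fun j hj => iprod i hi j hj, ?_⟩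
  rw [integral_finsetSum _ fun i hi => integrable_finsetSum _ fun j hj => iprod i hi j hj]
  calc _ ≤ ∑ i ∈ s, (1 : ℝ) := Finset.sum_le_sum fun i hi => ?_
    _ = s.card := by simp
  -- Off-diagonal terms vanish by `h2`; each diagonal term is a probability minus a nonnegative
  -- number.
  rw [integral_finsetSum _ fun j hj => iprod i hi j hj, Finset.sum_eq_single i]
  · rw [eprod i hi i hi]
    have : 0 ≤ ∫ ω, (ξ * ξ) ω ∂P := integral_nonneg fun ω => mul_self_nonneg _
    linarith [measureReal_le_one (μ := P) (s := B i ∩ B i)]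
  · intro j hj hji
    rw [eprod i hi j hj, sub_eq_zero, ← integral_congr_ae (h2 i hi j hj hji.symm),
      integral_condExp hm, integral_indicator_const _ ((hB i hi).inter (hB j hj)), smul_eq_mul,
      mul_one]
  · exact fun h => (h hi).elim

/-- Jensen's inequality for the square. -/
lemma lintegral_enorm_le_sqrt {Z : Ω → ℝ} (hZ : AEStronglyMeasurable Z P) {n : ℕ}
    (hi : Integrable (fun ω => Z ω ^ 2) P) (h : ∫ ω, Z ω ^ 2 ∂P ≤ n) :
    ∫⁻ ω, ‖Z ω‖ₑ ∂P ≤ ENNReal.ofReal (√n) := by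
  have iZ : Integrable Z P := ((memLp_two_iff_integrable_sq hZ).2 hi).integrable (by norm_num)
  rw [← ofReal_integral_norm_eq_lintegral_enorm iZ]
  refine ENNReal.ofReal_le_ofReal (Real.le_sqrt_of_sq_le ?_)
  refine le_trans ?_ h
  have := (convexOn_pow 2 (𝕜 := ℝ)).map_integral_le (μ := P) (f := fun ω => ‖Z ω‖)
    (by fun_prop) isClosed_Ici (by simp) iZ.norm (by simpa [Function.comp_def] using hi)
  simpa using this

end Counts

/-! ### Cell probabilities given the history -/

/-- The conditional probability of successive events `W`, `A`, `D`, where `W` is independent of the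
history and the later ones have known conditional probabilities given what precedes them. -/
lemma condProb_inter_of_sequential {Ω : Type*} {mH mW mA m0 : MeasurableSpace Ω} {P : Measure Ω}
    [IsProbabilityMeasure P] (hH : mH ≤ m0) (hW : mW ≤ m0) (hA : mA ≤ m0) {W A D : Set Ω}
    (sW : MeasurableSet[mW] W) (sA : MeasurableSet[mA] A) (sD : MeasurableSet D) {g : Ω → ℝ}
    (hg : StronglyMeasurable[mH] g) {K : ℝ} (hK : ∀ᵐ ω ∂P, ‖g ω‖ ≤ K) (ind : Indep mW mH P)
    (qA : ∀ᵐ ω ∂P, ω ∈ W → (P⟦A | mH ⊔ mW⟧) ω = g ω) {q : ℝ}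
    (qD : ∀ᵐ ω ∂P, ω ∈ W ∩ A → (P⟦D | mH ⊔ mW ⊔ mA⟧) ω = q) :
    P⟦W ∩ A ∩ D | mH⟧ =ᵐ[P] fun ω => P.real W * (g ω * q) := by
  have hHW : mH ⊔ mW ≤ m0 := sup_le hH hW
  have hHWA : mH ⊔ mW ⊔ mA ≤ m0 := sup_le hHW hA
  have sWA : MeasurableSet[mH ⊔ mW ⊔ mA] (W ∩ A) :=
    MeasurableSet.inter ((le_sup_right.trans le_sup_left : mW ≤ mH ⊔ mW ⊔ mA) _ sW)
      ((le_sup_right : mA ≤ mH ⊔ mW ⊔ mA) _ sA)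
  have iW : Integrable (W.indicator fun _ => (1 : ℝ)) P := (integrable_const 1).indicator (hW _ sW)
  have iA : Integrable (A.indicator fun _ => (1 : ℝ)) P := (integrable_const 1).indicator (hA _ sA)
  have iD : Integrable (D.indicator fun _ => (1 : ℝ)) P := (integrable_const 1).indicator sD
  have ig : Integrable (g * W.indicator fun _ => (1 : ℝ)) P :=
    iW.bdd_mul (hg.mono hH).aestronglyMeasurable hK
  -- Tower property from the finest σ-algebra down. Indicators that are already measurable are
  -- pulled out, so `qD` and `qA` matter only on `W ∩ A` and `W`.
  have step1 : P⟦W ∩ A ∩ D | mH ⊔ mW ⊔ mA⟧ =ᵐ[P] q • (W ∩ A).indicator fun _ => (1 : ℝ) := by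
    rw [← Set.indicator_indicator]
    filter_upwards [condExp_indicator iD sWA, qD] with ω h1 h2
    rw [h1]
    by_cases hω : ω ∈ W ∩ A
    · simp only [Set.indicator_of_mem hω, Pi.smul_apply, h2 hω, smul_eq_mul, mul_one]
    · simp only [Set.indicator_of_notMem hω, Pi.smul_apply, smul_zero]
  have step2 : P⟦W ∩ A | mH ⊔ mW⟧ =ᵐ[P] g * W.indicator fun _ => (1 : ℝ) := by
    rw [← Set.indicator_indicator]
    filter_upwards [condExp_indicator iA ((le_sup_right : mW ≤ mH ⊔ mW) _ sW), qA] with ω h1 h2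
    rw [h1]
    by_cases hω : ω ∈ W
    · simp only [Set.indicator_of_mem hω, Pi.mul_apply, h2 hω, mul_one]
    · simp only [Set.indicator_of_notMem hω, Pi.mul_apply, mul_zero]
  have step3 : P⟦W | mH⟧ =ᵐ[P] fun _ => P.real W := by
    refine (condExp_indep_eq hW hH (stronglyMeasurable_const.indicator sW) ind).trans
      (ae_of_all _ fun _ => ?_)
    rw [integral_indicator_const _ (hW _ sW), smul_eq_mul, mul_one]
  filter_upwards [condExp_condExp_of_le (μ := P) (f := (W ∩ A ∩ D).indicator fun _ => (1 : ℝ))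
      (le_sup_left.trans le_sup_left : mH ≤ mH ⊔ mW ⊔ mA) hHWA,
    condExp_condExp_of_le (μ := P) (f := (W ∩ A).indicator fun _ => (1 : ℝ))
      (le_sup_left : mH ≤ mH ⊔ mW) hHW,
    condExp_mul_of_stronglyMeasurable_left hg ig iW, condExp_congr_ae (m := mH) step1,
    condExp_congr_ae (m := mH) step2,
    condExp_smul (μ := P) q ((W ∩ A).indicator fun _ => (1 : ℝ)) mH, step3]
    with ω u1 u2 u3 u4 u5 u6 u7
  rw [← u1, u4, u6, Pi.smul_apply, ← u2, u5, u3, Pi.mul_apply, u7, smul_eq_mul]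
  ring

namespace Experiment

variable {Ω 𝒳 : Type*} {m0 : MeasurableSpace Ω} [MeasurableSpace 𝒳]
  {P : Measure Ω} {E : Experiment Ω 𝒳} {T : ℕ}
  {Q : Measure (𝒳 × (Fin 2 → ℝ))} {ρ : ℕ → 𝒳 → Fin 2 → ℝ}

/-- Given the history, covariate, potential outcomes and treatment, the delay is in `I` with
probability `q (X_i) (A_i)`. -/
def HasDelayProb (E : Experiment Ω 𝒳) (P : Measure Ω) (I : Set ℕ∞) (q : 𝒳 → Fin 2 → ℝ) : Prop :=
  ∀ i, P⟦E.D i ⁻¹' I |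
        E.history (E.S i - 1) ⊔ MeasurableSpace.comap (E.W i) inferInstance ⊔
          MeasurableSpace.comap (E.A i) inferInstance⟧
      =ᵐ[P] fun ω => q (E.X i ω) (E.A i ω)

lemma measurable_X (h : E.IIDUnits P Q) (i) : Measurable (E.X i) :=
  measurable_fst.comp (h.measurable_W i)

lemma measurable_Y (h : E.IIDUnits P Q) (i) : Measurable (E.Y i) :=
  measurable_snd.comp (h.measurable_W i)

lemma measurable_outcome (h : E.IIDUnits P Q) (h' : E.SequentialSampling T P ρ) (i) :
    Measurable (E.outcome i) := by
  have : Measurable fun z : (Fin 2 → ℝ) × Fin 2 => z.1 z.2 :=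
    measurable_from_prod_countable_left fun a => measurable_pi_apply a
  exact this.comp ((measurable_Y h i).prodMk (h'.measurable_A i))

lemma measurableSet_available (h' : E.SequentialSampling T P ρ) (t i) :
    MeasurableSet {ω | E.Available t i ω} :=
  h'.measurable_D i (MeasurableSet.of_discrete (s := {d : ℕ∞ | d + (E.S i : ℕ∞) ≤ t}))

lemma measurable_record (h : E.IIDUnits P Q) (h' : E.SequentialSampling T P ρ) (t i) :
    Measurable (E.record t i) := by
  unfold record
  exact (measurable_X h i).prodMk ((h'.measurable_A i).prodMk
    ((Measurable.ite (measurableSet_available h' t i) (h'.measurable_D i) measurable_const).prodMk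
      (Measurable.ite (measurableSet_available h' t i) (measurable_outcome h h' i)
        measurable_const)))

lemma history_le (h : E.IIDUnits P Q) (h' : E.SequentialSampling T P ρ) (t) :
    E.history t ≤ m0 :=
  iSup_le fun i => iSup_le fun _ => (measurable_record h h' t i).comap_le

lemma measurable_Z (h : E.IIDUnits P Q) (h' : E.SequentialSampling T P ρ) (i) :
    Measurable (E.Z i) :=
  (measurable_X h i).prodMk ((measurable_Y h i).prodMk
    ((h'.measurable_A i).prodMk (h'.measurable_D i)))

/-- Values of `Z` with covariates and potential outcomes in `C`, treatment `a`, delay in `I`. -/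
def cellSet (C : Set (𝒳 × (Fin 2 → ℝ))) (a : Fin 2) (I : Set ℕ∞) :
    Set (𝒳 × (Fin 2 → ℝ) × Fin 2 × ℕ∞) :=
  {z | (z.1, z.2.1) ∈ C ∧ z.2.2.1 = a ∧ z.2.2.2 ∈ I}

lemma measurableSet_cellSet {C : Set (𝒳 × (Fin 2 → ℝ))} (hC : MeasurableSet C) (a : Fin 2)
    (I : Set ℕ∞) : MeasurableSet (cellSet C a I) := by
  have h1 : Measurable fun z : 𝒳 × (Fin 2 → ℝ) × Fin 2 × ℕ∞ => (z.1, z.2.1) := by fun_prop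
  have h2 : Measurable fun z : 𝒳 × (Fin 2 → ℝ) × Fin 2 × ℕ∞ => z.2.2.1 := by fun_prop
  have h3 : Measurable fun z : 𝒳 × (Fin 2 → ℝ) × Fin 2 × ℕ∞ => z.2.2.2 := by fun_prop
  exact (h1 hC).inter ((h2 (measurableSet_singleton a)).inter (h3 MeasurableSet.of_discrete))

lemma stronglyMeasurable_armProb (h' : E.SequentialSampling T P ρ) {t : ℕ}
    (ht : t ∈ Finset.Icc 1 T) (x : 𝒳) (a : Fin 2) :
    StronglyMeasurable[E.history (t - 1)] fun ω => armProb (E.e t x ω) a :=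
  ((continuous_armProb a).measurable.comp (h'.adapted t ht x)).stronglyMeasurable

lemma norm_armProb_le {e : ℝ} (he : e ∈ Set.Icc (0 : ℝ) 1) (a : Fin 2) : ‖armProb e a‖ ≤ 1 := by
  unfold armProb
  rw [Real.norm_eq_abs, abs_le]
  split_ifs <;> constructor <;> linarith [he.1, he.2]

/-- On the slice `X = x` the assignment probability is a function of the history and the delay
probability is the constant `q x a`, as `condProb_inter_of_sequential` requires. -/
lemma condProb_cellSet [IsProbabilityMeasure P] (h : E.IIDUnits P Q)
    (h' : E.SequentialSampling T P ρ) {i : Fin E.N}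
    (hb : ∀ x, ∀ᵐ ω ∂P, E.e (E.S i) x ω ∈ Set.Icc (0 : ℝ) 1) {I : Set ℕ∞} {q : 𝒳 → Fin 2 → ℝ}
    (hq : E.HasDelayProb P I q) {C : Set (𝒳 × (Fin 2 → ℝ))} (hC : MeasurableSet C) {x : 𝒳}
    (hCx : ∀ z ∈ C, z.1 = x) (a : Fin 2) :
    P⟦E.Z i ⁻¹' cellSet C a I | E.history (E.S i - 1)⟧
      =ᵐ[P] fun ω => Q.real C * (armProb (E.e (E.S i) x ω) a * q x a) := by
  have e : E.Z i ⁻¹' cellSet C a I = E.W i ⁻¹' C ∩ {ω | E.A i ω = a} ∩ E.D i ⁻¹' I := by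
    ext ω
    simp [cellSet, Z, W, and_assoc]
  rw [e, ← h.law i, map_measureReal_apply (h.measurable_W i) hC]
  refine condProb_inter_of_sequential (history_le h h' _) (h.measurable_W i).comap_le
    (h'.measurable_A i).comap_le ⟨C, hC, rfl⟩ ⟨{a}, measurableSet_singleton a, rfl⟩
    (h'.measurable_D i MeasurableSet.of_discrete)
    (stronglyMeasurable_armProb h' (h'.stage_mem i) x a)
    ((hb x).mono fun ω hω => norm_armProb_le hω a) (h'.enrolment i) ?_ ?_
  · filter_upwards [h'.treatment i a] with ω hω hC'
    have hx : E.X i ω = x := hCx _ hC'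
    exact hω.trans (by rw [hx])
  · filter_upwards [hq i] with ω hω hC'
    have hx : E.X i ω = x := hCx _ hC'.1
    have ha : E.A i ω = a := hC'.2
    exact hω.trans (by rw [hx, ha])

end Experiment
/-! ### A law of large numbers for one stage -/

namespace Experiment

open Classical in
/-- The sum of `f (W_i)` over the participants of stage `s` with covariate `x`, treatment `a` and
delay in `I`. -/
noncomputable def stageSum {Ω 𝒳 : Type*} (E : Experiment Ω 𝒳) (s : ℕ) (x : 𝒳) (a : Fin 2)
    (I : Set ℕ∞) (f : 𝒳 × (Fin 2 → ℝ) → ℝ) (ω : Ω) : ℝ :=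
  ∑ i with E.S i = s, if E.X i ω = x ∧ E.A i ω = a ∧ E.D i ω ∈ I then f (E.W i ω) else 0

open Classical in
/-- The deviation of `stageSum` from its conditional expectation given the history, when the delay
is in `I` with conditional probability `q`. -/
noncomputable def stageDev {Ω 𝒳 : Type*} [MeasurableSpace 𝒳] (E : Experiment Ω 𝒳)
    (Q : Measure (𝒳 × (Fin 2 → ℝ))) (s : ℕ) (x : 𝒳) (a : Fin 2) (I : Set ℕ∞) (q : ℝ)
    (f : 𝒳 × (Fin 2 → ℝ) → ℝ) (ω : Ω) : ℝ :=
  ∑ i with E.S i = s, ((if E.X i ω = x ∧ E.A i ω = a ∧ E.D i ω ∈ I then f (E.W i ω) else 0)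
    - (∫ z in {z | z.1 = x}, f z ∂Q) * (armProb (E.e s x ω) a * q))

lemma stageSize_le {Ω 𝒳 : Type*} (E : Experiment Ω 𝒳) (s : ℕ) : E.stageSize s ≤ E.N := by
  simpa [stageSize] using Finset.card_filter_le (Finset.univ : Finset (Fin E.N)) fun i => E.S i = s

section Single

variable {Ω 𝒳 : Type*} {m0 : MeasurableSpace Ω} [MeasurableSpace 𝒳]
  {P : Measure Ω} {E : Experiment Ω 𝒳} {T : ℕ}
  {Q : Measure (𝒳 × (Fin 2 → ℝ))} {ρ : ℕ → 𝒳 → Fin 2 → ℝ} {s : ℕ} {x : 𝒳} {a : Fin 2}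
  {I : Set ℕ∞} {f g : 𝒳 × (Fin 2 → ℝ) → ℝ}

lemma stageDev_eq (q : ℝ) (ω : Ω) : E.stageDev Q s x a I q f ω = E.stageSum s x a I f ω -
    E.stageSize s * ((∫ z in {z | z.1 = x}, f z ∂Q) * (armProb (E.e s x ω) a * q)) := by
  simp [stageDev, stageSum, stageSize]

lemma stageDev_add (hf : IntegrableOn f {z | z.1 = x} Q) (hg : IntegrableOn g {z | z.1 = x} Q)
    (q : ℝ) (ω : Ω) : E.stageDev Q s x a I q (f + g) ω =
      E.stageDev Q s x a I q f ω + E.stageDev Q s x a I q g ω := by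
  have e : ∫ z in {z | z.1 = x}, (f + g) z ∂Q
      = ∫ z in {z | z.1 = x}, f z ∂Q + ∫ z in {z | z.1 = x}, g z ∂Q := integral_add hf hg
  simp only [stageDev]
  rw [← Finset.sum_add_distrib, e]
  refine Finset.sum_congr rfl fun i _ => ?_
  split_ifs
  · simp only [Pi.add_apply]; ring
  · ring

lemma stageDev_const_mul (c q : ℝ) (ω : Ω) :
    E.stageDev Q s x a I q (fun z => c * f z) ω = c * E.stageDev Q s x a I q f ω := by
  simp only [stageDev]
  rw [Finset.mul_sum, integral_const_mul]
  refine Finset.sum_congr rfl fun i _ => ?_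
  split_ifs <;> ring

variable [MeasurableSingletonClass 𝒳]

lemma measurableSet_fst_eq (x : 𝒳) : MeasurableSet {z : 𝒳 × (Fin 2 → ℝ) | z.1 = x} :=
  measurable_fst (measurableSet_singleton x)

lemma measurableSet_cell (h : E.IIDUnits P Q) (h' : E.SequentialSampling T P ρ) (i : Fin E.N) :
    MeasurableSet {ω | E.X i ω = x ∧ E.A i ω = a ∧ E.D i ω ∈ I} :=
  (measurable_X h i (measurableSet_singleton x)).inter
    ((h'.measurable_A i (measurableSet_singleton a)).inter
      (h'.measurable_D i MeasurableSet.of_discrete))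

lemma measurable_stageDev (h : E.IIDUnits P Q) (h' : E.SequentialSampling T P ρ)
    (hs : s ∈ Finset.Icc 1 T) (hf : Measurable f) (q : ℝ) :
    Measurable (E.stageDev Q s x a I q f) := by
  unfold stageDev
  refine Finset.measurable_fun_sum _ fun i _ => Measurable.sub ?_ ?_
  · exact Measurable.ite (measurableSet_cell h h' i) (hf.comp (h.measurable_W i)) measurable_const
  · exact (((stronglyMeasurable_armProb h' hs x a).mono (history_le h h' _)).measurable.mul_const
      _).const_mul _

/-- For an indicator, `stageDev` counts conditionally independent events minus their common
conditional probability `ξ`; the second-moment bound and Jensen's inequality apply. -/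
lemma lintegral_stageDev_indicator_le [IsProbabilityMeasure P] (h : E.IIDUnits P Q)
    (h' : E.SequentialSampling T P ρ) (hs : s ∈ Finset.Icc 1 T)
    (hb : ∀ x, ∀ᵐ ω ∂P, E.e s x ω ∈ Set.Icc (0 : ℝ) 1) {q : 𝒳 → Fin 2 → ℝ}
    (hq : E.HasDelayProb P I q) {B : Set (𝒳 × (Fin 2 → ℝ))} (hB : MeasurableSet B) :
    ∫⁻ ω, ‖E.stageDev Q s x a I (q x a) (B.indicator fun _ => 1) ω‖ₑ ∂P
      ≤ ENNReal.ofReal (√(E.stageSize s)) := by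
  have hC : MeasurableSet (B ∩ {z | z.1 = x}) := hB.inter (measurableSet_fst_eq x)
  obtain ⟨ξ, hξ⟩ : ∃ ξ : Ω → ℝ, ξ = fun ω => Q.real (B ∩ {z | z.1 = x}) *
      (armProb (E.e s x ω) a * q x a) := ⟨_, rfl⟩
  have hξm : StronglyMeasurable[E.history (s - 1)] ξ := by
    rw [hξ]
    exact ((stronglyMeasurable_armProb h' hs x a).mul_const _).const_mul _
  have hξb : ∀ᵐ ω ∂P, ‖ξ ω‖ ≤ ‖Q.real (B ∩ {z | z.1 = x})‖ * (1 * ‖q x a‖) := by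
    filter_upwards [hb x] with ω hω
    rw [hξ, norm_mul, norm_mul]
    gcongr
    exact norm_armProb_le hω a
  have hcell : ∀ i ∈ Finset.univ.filter fun i => E.S i = s,
      P⟦E.Z i ⁻¹' cellSet (B ∩ {z | z.1 = x}) a I | E.history (s - 1)⟧ =ᵐ[P] ξ := fun i hi => by
    have hi' : E.S i = s := (Finset.mem_filter.1 hi).2
    have := condProb_cellSet h h' (i := i) (hi' ▸ hb) hq hC (x := x) (fun z hz => hz.2) a
    rwa [hi', ← hξ] at this
  have hpair : ∀ i ∈ Finset.univ.filter fun i => E.S i = s,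
      ∀ j ∈ Finset.univ.filter fun i => E.S i = s, i ≠ j →
      P⟦E.Z i ⁻¹' cellSet (B ∩ {z | z.1 = x}) a I ∩ E.Z j ⁻¹' cellSet (B ∩ {z | z.1 = x}) a I |
        E.history (s - 1)⟧ =ᵐ[P] ξ * ξ := fun i hi j hj hij => by
    have := h'.withinStage s hs {i, j} (by
      simp only [Finset.mem_insert, Finset.mem_singleton]
      rintro k (rfl | rfl)
      · exact (Finset.mem_filter.1 hi).2
      · exact (Finset.mem_filter.1 hj).2) (fun _ => cellSet (B ∩ {z | z.1 = x}) a I)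
      (fun _ _ => measurableSet_cellSet hC a I)
    rw [Finset.prod_pair hij, Finset.set_biInter_insert, Finset.set_biInter_singleton] at this
    exact this.trans ((hcell i hi).mul (hcell j hj))
  obtain ⟨hi, hle⟩ := integral_sq_sum_indicator_sub_le (P := P)
    (Finset.univ.filter fun i => E.S i = s) (history_le h h' (s - 1))
    (fun i _ => measurable_Z h h' i (measurableSet_cellSet hC a I)) hξm hξb hcell hpair
  have e : E.stageDev Q s x a I (q x a) (B.indicator fun _ => 1) = fun ω =>
      ∑ i with E.S i = s, ((E.Z i ⁻¹' cellSet (B ∩ {z | z.1 = x}) a I).indicator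
        (fun _ => (1 : ℝ)) ω - ξ ω) := by
    funext ω
    refine Finset.sum_congr rfl fun i _ => ?_
    rw [hξ, setIntegral_indicator hB, setIntegral_const, smul_eq_mul, mul_one,
      Set.inter_comm _ B]
    congr 1
    have hmem : E.Z i ω ∈ cellSet (B ∩ {z | z.1 = x}) a I ↔
        (E.X i ω = x ∧ E.A i ω = a ∧ E.D i ω ∈ I) ∧ E.W i ω ∈ B := by
      simp only [cellSet, Z, W, Set.mem_ofPred_eq, Set.mem_inter_iff]
      tauto
    simp only [Set.indicator, Set.mem_preimage]
    by_cases h1 : E.X i ω = x ∧ E.A i ω = a ∧ E.D i ω ∈ I <;> by_cases h2 : E.W i ω ∈ B <;>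
      simp only [h1, h2, and_true, and_false, iff_true, iff_false, if_true, if_false] at hmem ⊢ <;>
      simp [hmem]
  rw [e]
  refine lintegral_enorm_le_sqrt ?_ hi hle
  rw [← e]
  exact (measurable_stageDev h h' hs (measurable_const.indicator hB) _).aestronglyMeasurable

/-- A crude triangle-inequality bound, without cancellation, for the error of approximating by
simple functions: `1` accounts for the sum and `‖q‖ₑ` for its centering. -/
lemma lintegral_stageDev_le [IsProbabilityMeasure P] (h : E.IIDUnits P Q)
    (h' : E.SequentialSampling T P ρ) (hs : s ∈ Finset.Icc 1 T)
    (hb : ∀ x, ∀ᵐ ω ∂P, E.e s x ω ∈ Set.Icc (0 : ℝ) 1) (hf : Measurable f) (q : ℝ) :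
    ∫⁻ ω, ‖E.stageDev Q s x a I q f ω‖ₑ ∂P
      ≤ E.stageSize s * ((1 + ‖q‖ₑ) * ∫⁻ z in {z | z.1 = x}, ‖f z‖ₑ ∂Q) := by
  classical
  have m1 : ∀ i, Measurable fun ω =>
      if E.X i ω = x ∧ E.A i ω = a ∧ E.D i ω ∈ I then f (E.W i ω) else 0 := fun i =>
    Measurable.ite (measurableSet_cell h h' i) (hf.comp (h.measurable_W i)) measurable_const
  have m2 : Measurable fun ω =>
      (∫ z in {z | z.1 = x}, f z ∂Q) * (armProb (E.e s x ω) a * q) :=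
    (((stronglyMeasurable_armProb h' hs x a).mono (history_le h h' _)).measurable.mul_const
      _).const_mul _
  have hterm : ∀ i, ∫⁻ ω, ‖(if E.X i ω = x ∧ E.A i ω = a ∧ E.D i ω ∈ I then f (E.W i ω) else 0)
      - (∫ z in {z | z.1 = x}, f z ∂Q) * (armProb (E.e s x ω) a * q)‖ₑ ∂P
      ≤ (1 + ‖q‖ₑ) * ∫⁻ z in {z | z.1 = x}, ‖f z‖ₑ ∂Q := fun i => by
    calc _ ≤ ∫⁻ ω, (‖if E.X i ω = x ∧ E.A i ω = a ∧ E.D i ω ∈ I then f (E.W i ω) else 0‖ₑ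
        + ‖(∫ z in {z | z.1 = x}, f z ∂Q) * (armProb (E.e s x ω) a * q)‖ₑ) ∂P :=
          lintegral_mono fun ω => enorm_sub_le
      _ = ∫⁻ ω, ‖if E.X i ω = x ∧ E.A i ω = a ∧ E.D i ω ∈ I then f (E.W i ω) else 0‖ₑ ∂P
        + ∫⁻ ω, ‖(∫ z in {z | z.1 = x}, f z ∂Q) * (armProb (E.e s x ω) a * q)‖ₑ ∂P :=
          lintegral_add_left (m1 i).enorm _
      _ ≤ ∫⁻ z in {z | z.1 = x}, ‖f z‖ₑ ∂Q + ‖q‖ₑ * ∫⁻ z in {z | z.1 = x}, ‖f z‖ₑ ∂Q := by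
        gcongr
        · rw [← lintegral_indicator (measurableSet_fst_eq x), ← h.law i,
            lintegral_map (hf.enorm.indicator (measurableSet_fst_eq x)) (h.measurable_W i)]
          refine lintegral_mono fun ω => ?_
          by_cases h1 : E.X i ω = x
          · rw [Set.indicator_of_mem (show E.W i ω ∈ {z | z.1 = x} from h1)]
            split_ifs <;> simp
          · simp [h1]
        · calc _ ≤ ∫⁻ ω, ‖q‖ₑ * ∫⁻ z in {z | z.1 = x}, ‖f z‖ₑ ∂Q ∂P := by
                refine lintegral_mono_ae ?_
                filter_upwards [hb x] with ω hω
                have h1 : ‖armProb (E.e s x ω) a‖ₑ ≤ 1 := by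
                  have := norm_armProb_le hω a
                  rwa [← ofReal_norm, ENNReal.ofReal_le_one]
                rw [enorm_mul, enorm_mul, mul_comm]
                gcongr
                · exact mul_le_of_le_one_left' h1
                · exact enorm_integral_le_lintegral_enorm _
            _ = _ := by simp
      _ = _ := by rw [add_mul, one_mul]
  calc _ ≤ ∫⁻ ω, ∑ i with E.S i = s,
        ‖(if E.X i ω = x ∧ E.A i ω = a ∧ E.D i ω ∈ I then f (E.W i ω) else 0)
          - (∫ z in {z | z.1 = x}, f z ∂Q) * (armProb (E.e s x ω) a * q)‖ₑ ∂P := by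
        refine lintegral_mono fun ω => ?_
        unfold stageDev
        convert enorm_sum_le _ _
    _ = ∑ i with E.S i = s, ∫⁻ ω,
        ‖(if E.X i ω = x ∧ E.A i ω = a ∧ E.D i ω ∈ I then f (E.W i ω) else 0)
          - (∫ z in {z | z.1 = x}, f z ∂Q) * (armProb (E.e s x ω) a * q)‖ₑ ∂P :=
        lintegral_finsetSum _ fun i _ => ((m1 i).sub m2).enorm
    _ ≤ ∑ i with E.S i = s, (1 + ‖q‖ₑ) * ∫⁻ z in {z | z.1 = x}, ‖f z‖ₑ ∂Q :=
        Finset.sum_le_sum fun i _ => hterm i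
    _ = _ := by rw [Finset.sum_const, nsmul_eq_mul, stageSize]

end Single

end Experiment

/-! ### The law of large numbers along the sequence of experiments -/

section Sequence

variable {𝒳 : Type*} [MeasurableSpace 𝒳] [MeasurableSingletonClass 𝒳] {Ω : ℕ → Type*}
  [∀ k, MeasurableSpace (Ω k)] {P : ∀ k, Measure (Ω k)} [∀ k, IsProbabilityMeasure (P k)]
  {E : ∀ k, Experiment (Ω k) 𝒳} {T : ℕ} {Q : Measure (𝒳 × (Fin 2 → ℝ))} [IsFiniteMeasure Q]
  {ρ : ℕ → 𝒳 → Fin 2 → ℝ} {s : ℕ} {I : Set ℕ∞}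

/-- The law of large numbers in mean for the participants of one stage. -/
theorem tendsto_lintegral_stageDev (h : ∀ k, (E k).IIDUnits (P k) Q)
    (h' : ∀ k, (E k).SequentialSampling T (P k) ρ) (hs : s ∈ Finset.Icc 1 T)
    (hb : ∀ k x, ∀ᵐ ω ∂(P k), (E k).e s x ω ∈ Set.Icc (0 : ℝ) 1)
    (hN : Tendsto (fun k => (E k).N) atTop atTop) {q : 𝒳 → Fin 2 → ℝ}
    (hq : ∀ k, (E k).HasDelayProb (P k) I q) (x : 𝒳) (a : Fin 2) {f : 𝒳 × (Fin 2 → ℝ) → ℝ}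
    (hf : Measurable f) (hfi : IntegrableOn f {z | z.1 = x} Q) :
    Tendsto (fun k => ‖((E k).N : ℝ)⁻¹‖ₑ *
      ∫⁻ ω, ‖(E k).stageDev Q s x a I (q x a) f ω‖ₑ ∂(P k)) atTop (𝓝 0) := by
  have hsize : ∀ k, ‖((E k).N : ℝ)⁻¹‖ₑ * ((E k).stageSize s : ENNReal) ≤ 1 := fun k => by
    have e : ((E k).stageSize s : ENNReal) = ‖((E k).stageSize s : ℝ)‖ₑ := by
      rw [Real.enorm_natCast]
    rw [e, ← enorm_mul, ← ofReal_norm, ENNReal.ofReal_le_one, Real.norm_of_nonneg (by positivity)]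
    have : ((E k).stageSize s : ℝ) ≤ (E k).N := by exact_mod_cast (E k).stageSize_le s
    rw [inv_mul_eq_div]
    exact div_le_one_of_le₀ this (by positivity)
  -- Indicators: `√(stageSize) / N ≤ 1 / √N`.
  have hind : ∀ (c : ℝ) ⦃B : Set (𝒳 × (Fin 2 → ℝ))⦄, MeasurableSet B →
      Tendsto (fun k => ‖((E k).N : ℝ)⁻¹‖ₑ *
        ∫⁻ ω, ‖(E k).stageDev Q s x a I (q x a) (B.indicator fun _ => c) ω‖ₑ ∂(P k))
        atTop (𝓝 0) := by
    intro c B hB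
    have e : (B.indicator fun _ => c) = fun z => c * B.indicator (fun _ => (1 : ℝ)) z := by
      funext z
      by_cases hz : z ∈ B <;> simp [hz]
    have l1 : Tendsto (fun k => ‖c‖ₑ * ENNReal.ofReal (√((E k).N : ℝ))⁻¹) atTop (𝓝 0) := by
      have : Tendsto (fun k => (√((E k).N : ℝ))⁻¹) atTop (𝓝 0) :=
        (Real.tendsto_sqrt_atTop.comp (tendsto_natCast_atTop_atTop.comp hN)).inv_tendsto_atTop
      have := ENNReal.Tendsto.const_mul (a := ‖c‖ₑ) (ENNReal.tendsto_ofReal this)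
        (Or.inr enorm_ne_top)
      simpa using this
    refine tendsto_of_tendsto_of_tendsto_of_le_of_le tendsto_const_nhds l1
      (fun _ => zero_le) fun k => ?_
    simp only [e, Experiment.stageDev_const_mul, enorm_mul]
    rw [lintegral_const_mul' _ _ enorm_ne_top, mul_left_comm]
    gcongr
    calc _ ≤ ‖((E k).N : ℝ)⁻¹‖ₑ * ENNReal.ofReal (√((E k).stageSize s)) := by
          gcongr
          exact Experiment.lintegral_stageDev_indicator_le (h k) (h' k) hs (hb k) (hq k) hB
      _ ≤ ENNReal.ofReal (((E k).N : ℝ)⁻¹) * ENNReal.ofReal (√((E k).N : ℝ)) := by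
          rw [Real.enorm_of_nonneg (by positivity)]
          gcongr
          exact (E k).stageSize_le s
      _ = ENNReal.ofReal (√((E k).N : ℝ))⁻¹ := by
          rw [← ENNReal.ofReal_mul (by positivity), inv_mul_eq_div, Real.sqrt_div_self]
  rw [ENNReal.tendsto_nhds_zero]
  intro ε hε
  -- With this `ε'` the crude bound for the remainder `f - g` is at most `ε / 2`, since `stageSize ≤
  -- N`.
  obtain ⟨ε', hε', hε'q⟩ : ∃ ε' : ENNReal, ε' ≠ 0 ∧ (1 + ‖q x a‖ₑ) * ε' ≤ ε / 2 := by
    refine ⟨ε / 2 / (1 + ‖q x a‖ₑ), ?_, ENNReal.mul_div_le⟩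
    exact (ENNReal.div_pos (ENNReal.half_pos hε.ne').ne' (by simp)).ne'
  obtain ⟨g, hg, hgm, hgi, hgt⟩ := MemLp.induction_dense ENNReal.one_ne_top
    (fun g => Measurable g ∧ IntegrableOn g {z | z.1 = x} Q ∧
      Tendsto (fun k => ‖((E k).N : ℝ)⁻¹‖ₑ *
        ∫⁻ ω, ‖(E k).stageDev Q s x a I (q x a) g ω‖ₑ ∂(P k)) atTop (𝓝 0))
    (fun c B hB _ ε _ => ⟨B.indicator fun _ => c, by simp, measurable_const.indicator hB,
      (integrable_const c).indicator hB, hind c hB⟩)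
    (fun g₁ g₂ ⟨m₁, i₁, t₁⟩ ⟨m₂, i₂, t₂⟩ => ⟨m₁.add m₂, i₁.add i₂, by
      have t := t₁.add t₂
      rw [add_zero] at t
      refine tendsto_of_tendsto_of_tendsto_of_le_of_le tendsto_const_nhds t
        (fun _ => zero_le) fun k => ?_
      simp only [Experiment.stageDev_add i₁ i₂]
      rw [← mul_add, ← lintegral_add_left
        (Experiment.measurable_stageDev (h k) (h' k) hs m₁ _).enorm]
      gcongr with ω
      exact enorm_add_le _ _⟩)
    (fun g hg => hg.1.aestronglyMeasurable) (memLp_one_iff_integrable.2 hfi) hε'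
  rw [eLpNorm_one_eq_lintegral_enorm] at hg
  filter_upwards [(ENNReal.tendsto_nhds_zero.1 hgt) (ε / 2) (ENNReal.half_pos hε.ne')] with k hk
  have e : f = g + (f - g) := by simp
  calc _ ≤ ‖((E k).N : ℝ)⁻¹‖ₑ * (∫⁻ ω, ‖(E k).stageDev Q s x a I (q x a) g ω‖ₑ ∂(P k)
          + ∫⁻ ω, ‖(E k).stageDev Q s x a I (q x a) (f - g) ω‖ₑ ∂(P k)) := by
        rw [← lintegral_add_left (Experiment.measurable_stageDev (h k) (h' k) hs hgm _).enorm]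
        gcongr with ω
        conv_lhs => rw [e]
        rw [Experiment.stageDev_add hgi (hfi.sub hgi)]
        exact enorm_add_le _ _
    _ ≤ ‖((E k).N : ℝ)⁻¹‖ₑ * ∫⁻ ω, ‖(E k).stageDev Q s x a I (q x a) g ω‖ₑ ∂(P k)
          + ‖((E k).N : ℝ)⁻¹‖ₑ * ((E k).stageSize s * ((1 + ‖q x a‖ₑ) * ε')) := by
        rw [mul_add]
        gcongr
        refine (Experiment.lintegral_stageDev_le (h k) (h' k) hs (hb k) (hf.sub hgm) _).trans ?_
        gcongr
    _ ≤ ε / 2 + 1 * (ε / 2) := by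
        rw [← mul_assoc]
        gcongr
        exact hsize k
    _ = ε := by rw [one_mul, ENNReal.add_halves]

/-! ### Convergence in probability as convergence along a filter -/

/-- The filter of events on the disjoint union of the probability spaces whose complements have
asymptotically vanishing probability. -/
def probFilter {Ω : ℕ → Type*} [∀ k, MeasurableSpace (Ω k)] (P : ∀ k, Measure (Ω k)) :
    Filter (Σ k, Ω k) where
  sets := {s | Tendsto (fun k => P k {ω | (⟨k, ω⟩ : Σ k, Ω k) ∉ s}) atTop (𝓝 0)}
  univ_sets := by simp
  sets_of_superset {s t} hs hst := tendsto_of_tendsto_of_tendsto_of_le_of_le tendsto_const_nhds hs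
    (fun _ => zero_le) fun k => measure_mono fun ω hω hω' => hω (hst hω')
  inter_sets {s t} hs ht := by
    have hst := Tendsto.add hs ht
    rw [add_zero] at hst
    refine tendsto_of_tendsto_of_tendsto_of_le_of_le tendsto_const_nhds hst
      (fun _ => zero_le) fun k => (measure_mono fun ω hω => ?_).trans (measure_union_le _ _)
    by_contra hc
    simp only [Set.mem_union, Set.mem_ofPred_eq, not_or, not_not] at hc
    exact hω ⟨hc.1, hc.2⟩

omit [∀ k, IsProbabilityMeasure (P k)] in
lemma eventually_probFilter {p : (Σ k, Ω k) → Prop} : (∀ᶠ y in probFilter P, p y) ↔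
    Tendsto (fun k => P k {ω | ¬ p ⟨k, ω⟩}) atTop (𝓝 0) := Iff.rfl

omit [∀ k, IsProbabilityMeasure (P k)] in
lemma eventually_probFilter_of_ae {p : (Σ k, Ω k) → Prop} (hp : ∀ k, ∀ᵐ ω ∂(P k), p ⟨k, ω⟩) :
    ∀ᶠ y in probFilter P, p y := by
  rw [eventually_probFilter]
  simp only [ae_iff] at hp
  simp [hp]

omit [∀ k, IsProbabilityMeasure (P k)] in
-- Any finite number of experiments is negligible, so deterministic limits in `k` carry over to
-- `probFilter P`.
lemma tendsto_fst_probFilter : Tendsto Sigma.fst (probFilter P) atTop := by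
  refine tendsto_atTop.2 fun n => eventually_probFilter.2 ?_
  refine tendsto_const_nhds.congr' ?_
  filter_upwards [eventually_ge_atTop n] with k hk
  simp [hk]

omit [∀ k, IsProbabilityMeasure (P k)] in
-- This makes the algebra of limits, continuous mapping and ultrafilter compactness available for
-- convergence in probability.
lemma tendstoInProb_iff {f : ∀ k, Ω k → ℝ} {c : ℝ} :
    TendstoInProb P f c ↔ Tendsto (fun y : Σ k, Ω k => f y.1 y.2) (probFilter P) (𝓝 c) := by
  rw [Metric.tendsto_nhds]
  simp only [eventually_probFilter, TendstoInProb, Real.dist_eq, not_lt]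

instance : (probFilter P).NeBot := by
  refine ⟨fun hbot => ?_⟩
  have : ∀ᶠ _ in probFilter P, False := by rw [hbot]; exact eventually_bot
  rw [eventually_probFilter] at this
  simp at this

omit [∀ k, IsProbabilityMeasure (P k)] in
-- Markov's inequality.
lemma tendsto_probFilter_zero_of_lintegral {f : ∀ k, Ω k → ℝ} (hf : ∀ k, Measurable (f k))
    (h : Tendsto (fun k => ∫⁻ ω, ‖f k ω‖ₑ ∂(P k)) atTop (𝓝 0)) :
    Tendsto (fun y : Σ k, Ω k => f y.1 y.2) (probFilter P) (𝓝 0) := by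
  rw [← tendstoInProb_iff]
  intro ε hε
  have hε' : ENNReal.ofReal ε ≠ 0 := by simpa using hε
  have l := ENNReal.Tendsto.const_mul (a := (ENNReal.ofReal ε)⁻¹) h
    (Or.inr (ENNReal.inv_ne_top.2 hε'))
  rw [mul_zero] at l
  refine tendsto_of_tendsto_of_tendsto_of_le_of_le tendsto_const_nhds l (fun _ => zero_le)
    fun k => ?_
  have := mul_meas_ge_le_lintegral (μ := P k) (hf k).enorm (ENNReal.ofReal ε)
  rw [← ENNReal.div_eq_inv_mul, ENNReal.le_div_iff_mul_le (Or.inl hε') (Or.inl ENNReal.ofReal_ne_top),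
    mul_comm]
  refine le_trans ?_ this
  gcongr
  rename_i ω
  intro hω
  rw [sub_zero] at hω
  rw [← ofReal_norm, Real.norm_eq_abs]
  exact ENNReal.ofReal_le_ofReal hω

end Sequence
/-! ### Delay probabilities -/

/-- The probability of a delay of exactly `ℓ` stages. -/
def delayIncrement {𝒳 : Type*} (ρ : ℕ → 𝒳 → Fin 2 → ℝ) : ℕ → 𝒳 → Fin 2 → ℝ
  | 0 => ρ 0
  | ℓ + 1 => fun x a => ρ (ℓ + 1) x a - ρ ℓ x a

lemma sum_delayIncrement {𝒳 : Type*} (ρ : ℕ → 𝒳 → Fin 2 → ℝ) (d : ℕ) (x : 𝒳) (a : Fin 2) :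
    ∑ ℓ ∈ Finset.range (d + 1), delayIncrement ρ ℓ x a = ρ d x a := by
  induction d with
  | zero => simp [delayIncrement]
  | succ d ih => rw [Finset.sum_range_succ, ih]; simp [delayIncrement]

namespace Experiment

section Single

variable {Ω 𝒳 : Type*} {m0 : MeasurableSpace Ω} [MeasurableSpace 𝒳]
  {P : Measure Ω} {E : Experiment Ω 𝒳} {T : ℕ}
  {Q : Measure (𝒳 × (Fin 2 → ℝ))} {ρ : ℕ → 𝒳 → Fin 2 → ℝ}

lemma hasDelayProb_Iic (h' : E.SequentialSampling T P ρ) (d : ℕ) :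
    E.HasDelayProb P (Set.Iic (d : ℕ∞)) (ρ d) := fun i => h'.delay i d

lemma hasDelayProb_univ [IsProbabilityMeasure P] (h : E.IIDUnits P Q)
    (h' : E.SequentialSampling T P ρ) : E.HasDelayProb P Set.univ fun _ _ => 1 := fun i => by
  rw [Set.preimage_univ, Set.indicator_univ, condExp_const]
  exact sup_le (sup_le (history_le h h' _) (h.measurable_W i).comap_le)
    (h'.measurable_A i).comap_le

/-- For `ℓ > 0`, the singleton is a difference of two consecutive sets `Set.Iic`, and conditional
expectation is linear. -/
lemma hasDelayProb_singleton [IsProbabilityMeasure P] (h' : E.SequentialSampling T P ρ) (ℓ : ℕ) :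
    E.HasDelayProb P {(ℓ : ℕ∞)} (delayIncrement ρ ℓ) := fun i => by
  cases ℓ with
  | zero =>
    have e : ({((0 : ℕ) : ℕ∞)} : Set ℕ∞) = Set.Iic ((0 : ℕ) : ℕ∞) := by ext d; simp
    rw [e]
    exact h'.delay i 0
  | succ ℓ =>
    have e : (E.D i ⁻¹' {((ℓ + 1 : ℕ) : ℕ∞)}).indicator (fun _ => (1 : ℝ)) =
        (E.D i ⁻¹' Set.Iic ((ℓ + 1 : ℕ) : ℕ∞)).indicator (fun _ => (1 : ℝ)) -
          (E.D i ⁻¹' Set.Iic (ℓ : ℕ∞)).indicator (fun _ => (1 : ℝ)) := by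
      funext ω
      have hle : E.D i ω ≤ ((ℓ + 1 : ℕ) : ℕ∞) ↔
          E.D i ω = ((ℓ + 1 : ℕ) : ℕ∞) ∨ E.D i ω ≤ (ℓ : ℕ∞) := by
        induction E.D i ω using ENat.recTopCoe with
        | top => simp only [top_le_iff, ENat.natCast_ne_top, ENat.top_ne_natCast, or_self]
        | coe n => simp only [Nat.cast_le, Nat.cast_inj]; omega
      have hne : E.D i ω = ((ℓ + 1 : ℕ) : ℕ∞) → ¬ E.D i ω ≤ (ℓ : ℕ∞) := fun h => by
        rw [h, Nat.cast_le]; omega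
      simp only [Pi.sub_apply, Set.indicator, Set.mem_preimage, Set.mem_singleton_iff, Set.mem_Iic,
        hle]
      by_cases h1 : E.D i ω = ((ℓ + 1 : ℕ) : ℕ∞)
      · simp only [h1, true_or, if_true]
        rw [if_neg (h1 ▸ hne h1), sub_zero]
      · simp only [h1, false_or, if_false, sub_self]
    rw [e]
    have hI : ∀ J : Set ℕ∞, Integrable ((E.D i ⁻¹' J).indicator fun _ => (1 : ℝ)) P := fun J =>
      (integrable_const 1).indicator (h'.measurable_D i MeasurableSet.of_discrete)
    exact (condExp_sub (hI _) (hI _) _).trans ((h'.delay i (ℓ + 1)).sub (h'.delay i ℓ))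

/-! ### The estimators in terms of sums over stages -/

/-- The sum of `f (W_i)` over the participants enrolled in stages `1, …, n` with covariate `x`,
treatment `a`, and delay in `J s` for stage `s`. -/
noncomputable def cellSum (E : Experiment Ω 𝒳) (n : ℕ) (x : 𝒳) (a : Fin 2) (J : ℕ → Set ℕ∞)
    (f : 𝒳 × (Fin 2 → ℝ) → ℝ) (ω : Ω) : ℝ :=
  ∑ s ∈ Finset.Icc 1 n, E.stageSum s x a (J s) f ω

lemma sum_eq_cellSum (h' : E.SequentialSampling T P ρ) (n : ℕ) (x : 𝒳) (a : Fin 2)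
    (J : ℕ → Set ℕ∞) (f : 𝒳 × (Fin 2 → ℝ) → ℝ) (ω : Ω) {p : Fin E.N → Prop} [DecidablePred p]
    (hp : ∀ i, p i ↔ E.X i ω = x ∧ E.A i ω = a ∧ E.D i ω ∈ J (E.S i) ∧ E.S i ≤ n) :
    ∑ i with p i, f (E.W i ω) = E.cellSum n x a J f ω := by
  classical
  simp only [cellSum, stageSum, Finset.sum_filter]
  rw [Finset.sum_comm]
  refine Finset.sum_congr rfl fun i _ => ?_
  rw [Finset.sum_ite_eq]
  have hS := Finset.mem_Icc.1 (h'.stage_mem i)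
  simp only [hp, Finset.mem_Icc, hS.1, true_and]
  by_cases h1 : E.S i ≤ n <;> simp [h1]

omit [MeasurableSpace 𝒳] in
-- The subtraction `t - E.S i` truncates at `0`, hence the separate condition `E.S i ≤ t`.
lemma available_iff (t : ℕ) (i : Fin E.N) (ω : Ω) :
    E.Available t i ω ↔ E.D i ω ∈ Set.Iic ((t - E.S i : ℕ) : ℕ∞) ∧ E.S i ≤ t := by
  unfold Available
  rw [Set.mem_Iic]
  induction E.D i ω using ENat.recTopCoe with
  | top => simp
  | coe n => norm_cast; omega

lemma sum_outcome_pow (h' : E.SequentialSampling T P ρ) (t : ℕ) (x : 𝒳) (a : Fin 2) (ω : Ω)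
    (j : ℕ) : ∑ i ∈ E.availableCell t x a ω, E.outcome i ω ^ j =
      E.cellSum t x a (fun s => Set.Iic ((t - s : ℕ) : ℕ∞)) (fun z => z.2 a ^ j) ω := by
  classical
  rw [← sum_eq_cellSum h' t x a _ _ ω
    (p := fun i => E.X i ω = x ∧ E.A i ω = a ∧ E.Available t i ω)
    (fun i => by rw [available_iff])]
  unfold availableCell
  refine Finset.sum_congr (by congr) fun i hi => ?_
  rw [outcome, (Finset.mem_filter.1 hi).2.2.1]
  rfl

lemma sigmaSqHat_eq (h' : E.SequentialSampling T P ρ) (t : ℕ) (x : 𝒳) (a : Fin 2) (ω : Ω) :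
    let M := fun j : ℕ =>
      E.cellSum t x a (fun s => Set.Iic ((t - s : ℕ) : ℕ∞)) (fun z => z.2 a ^ j) ω
    E.sigmaSqHat t x a ω = M 2 / M 0 - (M 1 / M 0) ^ 2 := by
  intro M
  have h0 : ((E.availableCell t x a ω).card : ℝ) = M 0 := by
    change _ = E.cellSum t x a _ _ ω
    rw [← sum_outcome_pow h' t x a ω 0]; simp
  have h1 : ∑ i ∈ E.availableCell t x a ω, E.outcome i ω = M 1 := by
    change _ = E.cellSum t x a _ _ ω
    rw [← sum_outcome_pow h' t x a ω 1]; simp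
  have h2 : ∑ i ∈ E.availableCell t x a ω, E.outcome i ω ^ 2 = M 2 := sum_outcome_pow h' t x a ω 2
  have hm : E.muHat t x a ω = M 1 / M 0 := by rw [muHat, h0, h1]
  have hs : ∑ i ∈ E.availableCell t x a ω, (E.outcome i ω - M 1 / M 0) ^ 2
      = M 2 - 2 * (M 1 / M 0) * M 1 + M 0 * (M 1 / M 0) ^ 2 := by
    rw [← h2, ← h0, ← h1, Finset.mul_sum, ← Finset.sum_sub_distrib, ← nsmul_eq_mul,
      ← Finset.sum_const, ← Finset.sum_add_distrib]
    exact Finset.sum_congr rfl fun i _ => by ring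
  rw [sigmaSqHat, hm, hs, h0]
  -- For an empty cell both sides are `0`, by the convention `x / 0 = 0`.
  by_cases h : M 0 = 0
  · simp [h]
  · field_simp
    ring

lemma card_eq_cellSum (h' : E.SequentialSampling T P ρ) (n : ℕ) (x : 𝒳) (a : Fin 2)
    (J : ℕ → Set ℕ∞) (ω : Ω) {p : Fin E.N → Prop} [DecidablePred p]
    (hp : ∀ i, p i ↔ E.X i ω = x ∧ E.A i ω = a ∧ E.D i ω ∈ J (E.S i) ∧ E.S i ≤ n) :
    ((Finset.univ.filter p).card : ℝ) = E.cellSum n x a J (fun _ => 1) ω := by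
  rw [← sum_eq_cellSum h' n x a J (fun _ => 1) ω hp]
  simp only [Finset.sum_const, nsmul_eq_mul, mul_one]

lemma delayHat_eq (h' : E.SequentialSampling T P ρ) {t ℓ : ℕ} (hℓ : ℓ ≤ t) (x : 𝒳) (a : Fin 2)
    (ω : Ω) : E.delayHat t ℓ x a ω = E.cellSum (t - ℓ) x a (fun _ => {(ℓ : ℕ∞)}) (fun _ => 1) ω /
      E.cellSum (t - ℓ) x a (fun _ => Set.univ) (fun _ => 1) ω := by
  rw [delayHat, card_eq_cellSum h', card_eq_cellSum h']
  · intro i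
    simp only [Set.mem_univ, true_and]
    rw [Nat.le_sub_iff_add_le hℓ]
  · intro i
    rw [Set.mem_singleton_iff, Nat.le_sub_iff_add_le hℓ]

/-- Splitting the count by arm brings the covariate share under the same law of large numbers as the
other estimators. -/
lemma pHat_eq (h' : E.SequentialSampling T P ρ) (t : ℕ) (x : 𝒳) (ω : Ω) :
    E.pHat t x ω = (E.cellSum t x 1 (fun _ => Set.univ) (fun _ => 1) ω +
      E.cellSum t x 0 (fun _ => Set.univ) (fun _ => 1) ω) /
      ∑ s ∈ Finset.Icc 1 t, (E.stageSize s : ℝ) := by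
  classical
  rw [pHat]
  congr 1
  · rw [← card_eq_cellSum h' t x 1 (fun _ => Set.univ) ω
        (p := fun i => E.X i ω = x ∧ E.A i ω = 1 ∧ E.S i ≤ t) (by simp),
      ← card_eq_cellSum h' t x 0 (fun _ => Set.univ) ω
        (p := fun i => E.X i ω = x ∧ E.A i ω = 0 ∧ E.S i ≤ t) (by simp), ← Nat.cast_add,
      ← Finset.card_union_of_disjoint, ← Finset.filter_or]
    · congr 2
      ext i
      have : E.A i ω = 1 ∨ E.A i ω = 0 := by omega
      simp only [Finset.mem_filter, Finset.mem_univ, true_and]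
      tauto
    · rw [Finset.disjoint_filter]
      rintro i - ⟨-, h1, -⟩ ⟨-, h2, -⟩
      rw [h1] at h2
      exact absurd h2 (by decide)
  · rw [← Nat.cast_sum]
    congr 1
    rw [Finset.card_eq_sum_card_fiberwise (t := Finset.Icc 1 t) (f := E.S)]
    · refine Finset.sum_congr rfl fun s hs => ?_
      rw [stageSize, Finset.filter_filter]
      congr 1
      ext i
      simp only [Finset.mem_filter, Finset.mem_univ, true_and, and_iff_right_iff_imp]
      rintro rfl
      exact (Finset.mem_Icc.1 hs).2
    · intro i hi
      have hS := Finset.mem_Icc.1 (h'.stage_mem i)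
      simp only [Finset.coe_filter, Finset.mem_univ, true_and, Set.mem_ofPred_eq] at hi
      simp [hS.1, hi]

end Single

end Experiment
/-! ### Conditional moments -/

section Moments

variable {𝒳 : Type*} [MeasurableSpace 𝒳] {Q : Measure (𝒳 × (Fin 2 → ℝ))} {x : 𝒳}

lemma setIntegral_one_eq_covProb : ∫ _ in {z | z.1 = x}, (1 : ℝ) ∂Q = covProb Q x := by
  simp [covProb]

lemma measure_fst_eq_ne_zero (hp : 0 < covProb Q x) : Q {z | z.1 = x} ≠ 0 := fun h => by
  simp [covProb, Measure.real, h] at hp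

lemma setIntegral_pow_div_covProb (j : ℕ) (a : Fin 2) :
    (∫ z in {z | z.1 = x}, z.2 a ^ j ∂Q) / covProb Q x = condMoment Q j x a := by
  rw [condMoment, condLaw, ProbabilityTheory.cond, integral_smul_measure, ENNReal.toReal_inv,
    smul_eq_mul, div_eq_inv_mul, covProb, Measure.real]

lemma integrableOn_pow [IsFiniteMeasure Q] (hp : 0 < covProb Q x) {a : Fin 2}
    (h4 : Integrable (fun z => z.2 a ^ 4) (condLaw Q x)) {j : ℕ} (hj : j ≤ 4) :
    IntegrableOn (fun z => z.2 a ^ j) {z | z.1 = x} Q := by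
  rw [condLaw, ProbabilityTheory.cond, integrable_smul_measure
    (ENNReal.inv_ne_zero.2 (measure_ne_top _ _))
    (ENNReal.inv_ne_top.2 (measure_fst_eq_ne_zero hp))] at h4
  refine Integrable.mono' (h4.norm.add (integrable_const 1)) ?_ (ae_of_all _ fun z => ?_)
  · exact ((measurable_pi_apply a).comp measurable_snd |>.pow_const j).aestronglyMeasurable
  · simp only [Pi.add_apply, norm_pow]
    -- `|y| ^ j` is at most `1` or at most `|y| ^ 4`, according to whether `|y| ≤ 1`.
    rcases le_total ‖z.2 a‖ 1 with h | h
    · linarith [pow_le_one₀ (norm_nonneg (z.2 a)) h (n := j), pow_nonneg (norm_nonneg (z.2 a)) 4]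
    · linarith [pow_le_pow_right₀ h hj]

end Moments

/-! ### Limits of the estimators -/

/-- `U` is a filter along which all events of asymptotically full probability occur and the
allocations converge to `e`. -/
structure ConvergesAlong {𝒳 : Type*} [MeasurableSpace 𝒳] {Ω : ℕ → Type*}
    [∀ k, MeasurableSpace (Ω k)] (P : ∀ k, Measure (Ω k)) (E : ∀ k, Experiment (Ω k) 𝒳) (T : ℕ)
    (Q : Measure (𝒳 × (Fin 2 → ℝ))) (ρ : ℕ → 𝒳 → Fin 2 → ℝ) (r : ℕ → ℝ)
    (U : Filter (Σ k, Ω k)) (e : ℕ → 𝒳 → ℝ) : Prop where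
  iid : ∀ k, (E k).IIDUnits (P k) Q
  sampling : ∀ k, (E k).SequentialSampling T (P k) ρ
  mem_Icc : ∀ k, ∀ s ∈ Finset.Icc 1 T, ∀ x, ∀ᵐ ω ∂(P k), (E k).e s x ω ∈ Set.Icc (0 : ℝ) 1
  covProb_pos : ∀ x, 0 < covProb Q x
  share_pos : ∀ t ∈ Finset.Icc 1 T, 0 < r t
  size : Tendsto (fun k => (E k).N) atTop atTop
  rate : ∀ t ∈ Finset.Icc 1 T, Tendsto (fun k => (E k).rHat t) atTop (𝓝 (r t))
  le : U ≤ probFilter P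
  mem_Ioo : ∀ s ∈ Finset.Icc 1 T, ∀ x, e s x ∈ Set.Ioo (0 : ℝ) 1
  tendsto : ∀ s ∈ Finset.Icc 1 T, ∀ x,
    Tendsto (fun y : Σ k, Ω k => (E y.1).e s x y.2) U (𝓝 (e s x))

namespace ConvergesAlong

variable {𝒳 : Type*} [MeasurableSpace 𝒳] [MeasurableSingletonClass 𝒳] {Ω : ℕ → Type*}
  [∀ k, MeasurableSpace (Ω k)] {P : ∀ k, Measure (Ω k)} [∀ k, IsProbabilityMeasure (P k)]
  {E : ∀ k, Experiment (Ω k) 𝒳} {T : ℕ} {Q : Measure (𝒳 × (Fin 2 → ℝ))} [IsFiniteMeasure Q]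
  {ρ : ℕ → 𝒳 → Fin 2 → ℝ} {r : ℕ → ℝ} {U : Filter (Σ k, Ω k)} {e : ℕ → 𝒳 → ℝ}
  {f g : 𝒳 × (Fin 2 → ℝ) → ℝ} {x : 𝒳} {a : Fin 2}

omit [MeasurableSingletonClass 𝒳] [∀ k, IsProbabilityMeasure (P k)] [IsFiniteMeasure Q] in
lemma tendsto_fst (H : ConvergesAlong P E T Q ρ r U e) : Tendsto Sigma.fst U atTop :=
  tendsto_fst_probFilter.mono_left H.le

omit [MeasurableSingletonClass 𝒳] [∀ k, IsProbabilityMeasure (P k)] [IsFiniteMeasure Q] in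
lemma tendsto_rHat (H : ConvergesAlong P E T Q ρ r U e) {s : ℕ} (hs : s ∈ Finset.Icc 1 T) :
    Tendsto (fun y : Σ k, Ω k => (E y.1).rHat s) U (𝓝 (r s)) :=
  (H.rate s hs).comp H.tendsto_fst

omit [MeasurableSingletonClass 𝒳] [∀ k, IsProbabilityMeasure (P k)] [IsFiniteMeasure Q] in
lemma eventually_size_ne (H : ConvergesAlong P E T Q ρ r U e) :
    ∀ᶠ y : Σ k, Ω k in U, ((E y.1).N : ℝ) ≠ 0 := by
  have : ∀ᶠ k in atTop, ((E k).N : ℝ) ≠ 0 := by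
    filter_upwards [H.size.eventually_ge_atTop 1] with k hk
    have : 0 < (E k).N := hk
    positivity
  exact H.tendsto_fst.eventually this

/-- The deviation from the conditional mean is negligible in probability, and the conditional mean
depends on the data only through the allocation, which converges along `U`. -/
lemma tendsto_stageSum (H : ConvergesAlong P E T Q ρ r U e) {s : ℕ} (hs : s ∈ Finset.Icc 1 T)
    {I : Set ℕ∞} {q : 𝒳 → Fin 2 → ℝ} (hq : ∀ k, (E k).HasDelayProb (P k) I q)
    (hf : Measurable f) (hfi : IntegrableOn f {z | z.1 = x} Q) :
    Tendsto (fun y : Σ k, Ω k => (E y.1).stageSum s x a I f y.2 / (E y.1).N) U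
      (𝓝 ((∫ z in {z | z.1 = x}, f z ∂Q) * (r s * armProb (e s x) a * q x a))) := by
  have l1 : Tendsto (fun y : Σ k, Ω k =>
      ((E y.1).N : ℝ)⁻¹ * (E y.1).stageDev Q s x a I (q x a) f y.2) U (𝓝 0) := by
    refine (tendsto_probFilter_zero_of_lintegral (P := P)
      (f := fun k ω => ((E k).N : ℝ)⁻¹ * (E k).stageDev Q s x a I (q x a) f ω)
      (fun k => (Experiment.measurable_stageDev (H.iid k) (H.sampling k) hs hf _).const_mul _)
      ?_).mono_left H.le
    simp only [enorm_mul]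
    simp_rw [lintegral_const_mul' _ _ enorm_ne_top]
    exact tendsto_lintegral_stageDev H.iid H.sampling hs (fun k x => H.mem_Icc k s hs x) H.size hq
      x a hf hfi
  have l2 : Tendsto (fun y : Σ k, Ω k => (E y.1).rHat s *
      ((∫ z in {z | z.1 = x}, f z ∂Q) * (armProb ((E y.1).e s x y.2) a * q x a))) U
      (𝓝 (r s * ((∫ z in {z | z.1 = x}, f z ∂Q) * (armProb (e s x) a * q x a)))) :=
    (H.tendsto_rHat hs).mul (tendsto_const_nhds.mul
      ((((continuous_armProb a).tendsto _).comp (H.tendsto s hs x)).mul_const _))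
  have l := l1.add l2
  rw [zero_add] at l
  convert l using 2
  · rw [Experiment.stageDev_eq, Experiment.rHat]
    ring
  · ring

lemma tendsto_cellSum (H : ConvergesAlong P E T Q ρ r U e) {n : ℕ} (hn : n ≤ T)
    {J : ℕ → Set ℕ∞} {q : ℕ → 𝒳 → Fin 2 → ℝ} (hq : ∀ s k, (E k).HasDelayProb (P k) (J s) (q s))
    (hf : Measurable f) (hfi : IntegrableOn f {z | z.1 = x} Q) :
    Tendsto (fun y : Σ k, Ω k => (E y.1).cellSum n x a J f y.2 / (E y.1).N) U
      (𝓝 ((∫ z in {z | z.1 = x}, f z ∂Q) *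
        ∑ s ∈ Finset.Icc 1 n, r s * armProb (e s x) a * q s x a)) := by
  simp only [Experiment.cellSum, Finset.sum_div, Finset.mul_sum]
  exact tendsto_finsetSum _ fun s hs =>
    H.tendsto_stageSum (Finset.Icc_subset_Icc_right hn hs) (hq s) hf hfi

/-- Monotonicity of `ρ` in `d` is not assumed: it is read off from the experiment, as the limit of
an inequality between counts of stage-`1` participants. -/
lemma delay_zero_le [U.NeBot] (H : ConvergesAlong P E T Q ρ r U e) (hT : 1 ≤ T) (d : ℕ) (x : 𝒳)
    (a : Fin 2) : ρ 0 x a ≤ ρ d x a := by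
  have h1 : 1 ∈ Finset.Icc 1 T := by simp [hT]
  have l : ∀ d : ℕ, Tendsto (fun y : Σ k, Ω k =>
      (E y.1).stageSum 1 x a (Set.Iic (d : ℕ∞)) (fun _ => 1) y.2 / (E y.1).N) U
      (𝓝 (covProb Q x * (r 1 * armProb (e 1 x) a * ρ d x a))) := fun d => by
    rw [← setIntegral_one_eq_covProb]
    exact H.tendsto_stageSum h1 (fun k => Experiment.hasDelayProb_Iic (H.sampling k) d)
      measurable_const (integrable_const 1)
  have := le_of_tendsto_of_tendsto (l 0) (l d) (Eventually.of_forall fun y => by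
    dsimp only
    gcongr
    unfold Experiment.stageSum
    refine Finset.sum_le_sum fun i _ => ?_
    split_ifs with c1 c2
    · exact le_rfl
    · exact absurd ⟨c1.1, c1.2.1, Set.mem_Iic.2 ((Set.mem_Iic.1 c1.2.2).trans
        (Nat.cast_le.2 (Nat.zero_le d)))⟩ c2
    · exact zero_le_one
    · exact le_rfl)
  have hr := H.share_pos 1 h1
  have ha := armProb_pos (H.mem_Ioo 1 h1 x).1 (H.mem_Ioo 1 h1 x).2 a
  have hp := H.covProb_pos x
  exact le_of_mul_le_mul_left (le_of_mul_le_mul_left this hp) (mul_pos hr ha)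

omit [MeasurableSingletonClass 𝒳] [∀ k, IsProbabilityMeasure (P k)] [IsFiniteMeasure Q] in
lemma sum_share_pos (H : ConvergesAlong P E T Q ρ r U e) {n : ℕ} (h1 : 1 ≤ n) (hn : n ≤ T)
    {q : ℕ → ℝ} (hq : ∀ s, 0 < q s) (x : 𝒳) (a : Fin 2) :
    0 < ∑ s ∈ Finset.Icc 1 n, r s * armProb (e s x) a * q s := by
  refine Finset.sum_pos (fun s hs => ?_) ⟨1, by simp [h1]⟩
  have hs' := Finset.Icc_subset_Icc_right hn hs
  have := H.share_pos s hs'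
  have := armProb_pos (H.mem_Ioo s hs' x).1 (H.mem_Ioo s hs' x).2 a
  have := hq s
  positivity

omit [MeasurableSingletonClass 𝒳] [∀ k, IsProbabilityMeasure (P k)] [IsFiniteMeasure Q] in
lemma tendsto_div_of_tendsto_div_size (H : ConvergesAlong P E T Q ρ r U e) {b c : (Σ k, Ω k) → ℝ}
    {β γ : ℝ} (hb : Tendsto (fun y => b y / (E y.1).N) U (𝓝 β))
    (hc : Tendsto (fun y => c y / (E y.1).N) U (𝓝 γ)) (hγ : γ ≠ 0) :
    Tendsto (fun y => b y / c y) U (𝓝 (β / γ)) := by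
  refine (hb.div hc hγ).congr' ?_
  filter_upwards [H.eventually_size_ne] with y hy
  exact div_div_div_cancel_right₀ hy _ _

lemma tendsto_pHat (H : ConvergesAlong P E T Q ρ r U e) {t : ℕ} (ht : t ∈ Finset.Icc 1 T)
    (x : 𝒳) : Tendsto (fun y : Σ k, Ω k => (E y.1).pHat t x y.2) U (𝓝 (covProb Q x)) := by
  have ht' := Finset.mem_Icc.1 ht
  have l : ∀ a, Tendsto (fun y : Σ k, Ω k =>
      (E y.1).cellSum t x a (fun _ => Set.univ) (fun _ => 1) y.2 / (E y.1).N) U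
      (𝓝 (covProb Q x * ∑ s ∈ Finset.Icc 1 t, r s * armProb (e s x) a * 1)) := fun a => by
    rw [← setIntegral_one_eq_covProb]
    exact H.tendsto_cellSum (q := fun _ _ _ => 1) ht'.2
      (fun _ k => Experiment.hasDelayProb_univ (H.iid k) (H.sampling k))
      measurable_const (integrable_const 1)
  have lc : Tendsto (fun y : Σ k, Ω k =>
      (∑ s ∈ Finset.Icc 1 t, ((E y.1).stageSize s : ℝ)) / (E y.1).N) U
      (𝓝 (∑ s ∈ Finset.Icc 1 t, r s)) := by
    simp only [Finset.sum_div]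
    exact tendsto_finsetSum _ fun s hs => H.tendsto_rHat (Finset.Icc_subset_Icc_right ht'.2 hs)
  have hpos : 0 < ∑ s ∈ Finset.Icc 1 t, r s := Finset.sum_pos
    (fun s hs => H.share_pos s (Finset.Icc_subset_Icc_right ht'.2 hs)) ⟨1, by simp [ht'.1]⟩
  have lb := (l 1).add (l 0)
  simp only [← add_div] at lb
  have := H.tendsto_div_of_tendsto_div_size lb lc hpos.ne'
  simp only [Experiment.pHat_eq (H.sampling _)]
  convert this using 2
  rw [eq_div_iff hpos.ne', ← mul_add, ← Finset.sum_add_distrib]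
  congr 1
  exact Finset.sum_congr rfl fun s _ => by simp [armProb]; ring

/-- The exact-delay probability does not depend on the enrolment stage, so the allocation-weighted
shares cancel between numerator and denominator. -/
lemma tendsto_delayHat (H : ConvergesAlong P E T Q ρ r U e) {t ℓ : ℕ} (hℓ : ℓ < t) (ht : t ≤ T)
    (x : 𝒳) (a : Fin 2) : Tendsto (fun y : Σ k, Ω k => (E y.1).delayHat t ℓ x a y.2) U
      (𝓝 (delayIncrement ρ ℓ x a)) := by
  have lb := H.tendsto_cellSum (n := t - ℓ) (x := x) (a := a) (f := fun _ => 1) (by omega)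
    (q := fun _ => delayIncrement ρ ℓ)
    (fun _ k => Experiment.hasDelayProb_singleton (H.sampling k) ℓ) measurable_const
    (integrable_const 1)
  have lc := H.tendsto_cellSum (n := t - ℓ) (x := x) (a := a) (f := fun _ => 1) (by omega)
    (q := fun _ _ _ => 1)
    (fun _ k => Experiment.hasDelayProb_univ (H.iid k) (H.sampling k)) measurable_const
    (integrable_const 1)
  have hpos := mul_pos (H.covProb_pos x)
    (H.sum_share_pos (n := t - ℓ) (q := fun _ => 1) (by omega) (by omega) (fun _ => one_pos) x a)
  rw [setIntegral_one_eq_covProb] at lb lc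
  simp only [Experiment.delayHat_eq (H.sampling _) hℓ.le]
  convert H.tendsto_div_of_tendsto_div_size lb lc hpos.ne' using 2
  rw [eq_div_iff hpos.ne', ← Finset.sum_mul, ← Finset.sum_mul]
  ring

lemma tendsto_rhoHat (H : ConvergesAlong P E T Q ρ r U e) {t : ℕ} (ht : t ∈ Finset.Icc 1 T)
    (d : ℕ) (x : 𝒳) (a : Fin 2) : Tendsto (fun y : Σ k, Ω k => (E y.1).rhoHat t d x a y.2) U
      (𝓝 (conservative ρ t d x a)) := by
  have ht' := Finset.mem_Icc.1 ht
  have l : ∀ d < t, Tendsto (fun y : Σ k, Ω k =>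
      ∑ ℓ ∈ Finset.range (d + 1), (E y.1).delayHat t ℓ x a y.2) U (𝓝 (ρ d x a)) := fun d hd => by
    rw [← sum_delayIncrement ρ]
    exact tendsto_finsetSum _ fun ℓ hℓ =>
      H.tendsto_delayHat (by have := Finset.mem_range.1 hℓ; omega) ht'.2 x a
  simp only [Experiment.rhoHat, conservative_eq _ ht'.1]
  exact l _ (by omega)

lemma tendsto_sigmaSqHat [U.NeBot] (H : ConvergesAlong P E T Q ρ r U e) {t : ℕ}
    (ht : t ∈ Finset.Icc 1 T) (hρ : ∀ x a, 0 < ρ 0 x a)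
    (h4 : Integrable (fun z => z.2 a ^ 4) (condLaw Q x)) :
    Tendsto (fun y : Σ k, Ω k => (E y.1).sigmaSqHat t x a y.2) U (𝓝 (condVariance Q x a)) := by
  have ht' := Finset.mem_Icc.1 ht
  have hpos := H.sum_share_pos ht'.1 ht'.2 (q := fun s => ρ (t - s) x a)
    (fun s => (hρ x a).trans_le (H.delay_zero_le (ht'.1.trans ht'.2) _ x a)) x a
  have l : ∀ j ≤ 4, Tendsto (fun y : Σ k, Ω k =>
      (E y.1).cellSum t x a (fun s => Set.Iic ((t - s : ℕ) : ℕ∞)) (fun z => z.2 a ^ j) y.2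
        / (E y.1).N) U (𝓝 ((∫ z in {z | z.1 = x}, z.2 a ^ j ∂Q) *
          ∑ s ∈ Finset.Icc 1 t, r s * armProb (e s x) a * ρ (t - s) x a)) := fun j hj =>
    H.tendsto_cellSum ht'.2 (q := fun s => ρ (t - s))
      (fun s k => Experiment.hasDelayProb_Iic (H.sampling k) (t - s))
      ((measurable_pi_apply a).comp measurable_snd |>.pow_const j)
      (integrableOn_pow (H.covProb_pos x) h4 hj)
  -- Delays are independent of potential outcomes given covariate and arm, so the same availability
  -- factor multiplies every moment and cancels: selection by availability causes no bias.
  have l' : ∀ j ≤ 4, Tendsto (fun y : Σ k, Ω k =>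
      (E y.1).cellSum t x a (fun s => Set.Iic ((t - s : ℕ) : ℕ∞)) (fun z => z.2 a ^ j) y.2 /
      (E y.1).cellSum t x a (fun s => Set.Iic ((t - s : ℕ) : ℕ∞)) (fun z => z.2 a ^ 0) y.2) U
      (𝓝 (condMoment Q j x a)) := fun j hj => by
    have l0 := l 0 (by norm_num)
    have e0 : ∫ z in {z : 𝒳 × (Fin 2 → ℝ) | z.1 = x}, z.2 a ^ 0 ∂Q = covProb Q x := by
      simp only [pow_zero, setIntegral_one_eq_covProb]
    rw [e0] at l0
    rw [← setIntegral_pow_div_covProb, ← mul_div_mul_right _ _ hpos.ne']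
    exact H.tendsto_div_of_tendsto_div_size (l j hj) l0 (mul_pos (H.covProb_pos x) hpos).ne'
  simp only [Experiment.sigmaSqHat_eq (H.sampling _)]
  exact (l' 2 (by norm_num)).sub ((l' 1 (by norm_num)).pow 2)

/-- A limit of empirical variances, which are averages of squares. -/
lemma condVariance_nonneg [U.NeBot] (H : ConvergesAlong P E T Q ρ r U e) (hT : 1 ≤ T)
    (hρ : ∀ x a, 0 < ρ 0 x a) (h4 : Integrable (fun z => z.2 a ^ 4) (condLaw Q x)) :
    0 ≤ condVariance Q x a :=
  ge_of_tendsto' (H.tendsto_sigmaSqHat (t := 1) (by simp [hT]) hρ h4) fun y =>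
    div_nonneg (Finset.sum_nonneg fun _ _ => sq_nonneg _) (Nat.cast_nonneg _)

end ConvergesAlong

/-! ### Limits of the allocations -/

lemma Experiment.FollowsDesign.mem_Icc {Ω 𝒳 : Type*} [Fintype 𝒳] [MeasurableSpace Ω]
    {E : Experiment Ω 𝒳} {δ : ℝ} {T : ℕ} {P : Measure Ω} (h : E.FollowsDesign δ T P)
    (hδ' : δ < 1 / 2) {s : ℕ} (hs : s ∈ Finset.Icc 1 T) :
    ∀ᵐ ω ∂P, ∀ x, E.e s x ω ∈ Set.Icc δ (1 - δ) := by
  have hs' := Finset.mem_Icc.1 hs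
  obtain rfl | h1 := eq_or_lt_of_le hs'.1
  · filter_upwards [h.initial] with ω hω x
    rw [hω]; constructor <;> linarith
  · obtain ⟨t, rfl⟩ : ∃ t, s = t + 1 := ⟨s - 1, by omega⟩
    filter_upwards [h.step t (by omega) (by omega)] with ω ⟨u, hu, hue⟩ x
    rw [hue]
    exact hu.feasible _ (by simp; omega) x

/-- Compactness; an ultrafilter serves all bounded quantities at once, with no extraction of
subsequences. -/
lemma exists_tendsto_of_eventually_mem_Icc {α : Type*} (U : Ultrafilter α) {g : α → ℝ} {b c : ℝ}
    (h : ∀ᶠ y in U, g y ∈ Set.Icc b c) : ∃ l ∈ Set.Icc b c, Tendsto g U (𝓝 l) :=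
  isCompact_Icc.ultrafilter_le_nhds (U.map g) (le_principal_iff.2 h)

end DelayedCARA

/-! ### Existence of the limit allocation and convergence in probability -/

open DelayedCARA

theorem theorem6 {𝒳 : Type*} [Fintype 𝒳] [MeasurableSpace 𝒳] [MeasurableSingletonClass 𝒳]
    {Ω : ℕ → Type*} [∀ k, MeasurableSpace (Ω k)]
    (P : ∀ k, Measure (Ω k)) [∀ k, IsProbabilityMeasure (P k)]
    (E : ∀ k, Experiment (Ω k) 𝒳)
    (T : ℕ) (δ : ℝ) (hδ : 0 < δ) (hδ' : δ < 1 / 2)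
    (Q : Measure (𝒳 × (Fin 2 → ℝ))) [IsProbabilityMeasure Q]
    (ρ : ℕ → 𝒳 → Fin 2 → ℝ) (r : ℕ → ℝ)
    -- covariates and potential outcomes
    (hiid : ∀ k, (E k).IIDUnits (P k) Q)
    (hp : ∀ x, 0 < covProb Q x)
    (hmoment : ∀ x a, Integrable (fun z => (z.2 a) ^ 4) (condLaw Q x))
    (hvar : ∀ x, condVariance Q x 0 ≠ 0 ∨ condVariance Q x 1 ≠ 0)
    -- treatment assignment and delay mechanism
    (hseq : ∀ k, (E k).SequentialSampling T (P k) ρ)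
    -- immediate availability with positive probability
    (hρ : ∀ x a, 0 < ρ 0 x a)
    -- asymptotic regime
    (hr : ∀ t ∈ Finset.Icc 1 T, 0 < r t)
    (hn : ∀ t ∈ Finset.Icc 1 T, Tendsto (fun k => (E k).stageSize t) atTop atTop)
    (hrate : ∀ t ∈ Finset.Icc 1 T, Tendsto (fun k => (E k).rHat t) atTop (𝓝 (r t)))
    -- variation in the delay mechanism
    (hratio : ∀ x, ∀ d < T, ∀ d' < T, d ≠ d' → ρ d x 1 / ρ d x 0 ≠ ρ d' x 1 / ρ d' x 0)
    -- fully forward-looking design, conservative extrapolation, tie-breaking, bounds [δ, 1 - δ]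
    (hdesign : ∀ k, (E k).FollowsDesign δ T (P k)) :
    (∃ eDag : ℕ → 𝒳 → ℝ, IsLimitAllocation δ T (covProb Q) (condVariance Q) r ρ eDag) ∧
    ∀ eDag : ℕ → 𝒳 → ℝ, IsLimitAllocation δ T (covProb Q) (condVariance Q) r ρ eDag →
      ∀ t ∈ Finset.Icc 1 T, ∀ x, ∀ a : Fin 2,
        TendstoInProb P (fun k ω => armProb ((E k).e t x ω) a) (armProb (eDag t x) a) := by
  rcases Nat.eq_zero_or_pos T with rfl | hT
  · exact ⟨⟨fun _ _ => 1 / 2, fun _ => rfl, fun t _ ht => absurd ht (Nat.not_lt_zero t)⟩,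
      fun _ _ t ht => by simp at ht⟩
  -- Every ultrafilter limit of the allocations solves the population recursion.
  -- `PopulationConditions` is part of the claim because positivity of `ρ` and nonnegativity of the
  -- variances are themselves obtained along `U`.
  have main : ∀ U : Ultrafilter (Σ k, Ω k), ↑U ≤ probFilter P →
      PopulationConditions T (covProb Q) (condVariance Q) r ρ ∧
      ∃ e, IsLimitAllocation δ T (covProb Q) (condVariance Q) r ρ e ∧ ∀ s ∈ Finset.Icc 1 T, ∀ x,
        Tendsto (fun y : Σ k, Ω k => (E y.1).e s x y.2) U (𝓝 (e s x)) := by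
    intro U hU
    have hlim : ∀ s x, ∃ l, s ∈ Finset.Icc 1 T → l ∈ Set.Icc δ (1 - δ) ∧
        Tendsto (fun y : Σ k, Ω k => (E y.1).e s x y.2) U (𝓝 l) := by
      intro s x
      by_cases hs : s ∈ Finset.Icc 1 T
      · obtain ⟨l, hl, hl'⟩ := exists_tendsto_of_eventually_mem_Icc U
          (hU (eventually_probFilter_of_ae (P := P)
            (p := fun y : Σ k, Ω k => (E y.1).e s x y.2 ∈ Set.Icc δ (1 - δ))
            fun k => ((hdesign k).mem_Icc hδ' hs).mono fun ω hω => hω x))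
        exact ⟨l, fun _ => ⟨hl, hl'⟩⟩
      · exact ⟨0, fun h => absurd h hs⟩
    choose e he using hlim
    have H : ConvergesAlong P E T Q ρ r U e :=
      { iid := hiid
        sampling := hseq
        mem_Icc := fun k s hs x => ((hdesign k).mem_Icc hδ' hs).mono fun ω hω =>
          ⟨by linarith [(hω x).1], by linarith [(hω x).2]⟩
        covProb_pos := hp
        share_pos := hr
        size := tendsto_atTop_mono (fun k => (E k).stageSize_le 1) (hn 1 (by simp; omega))
        rate := hrate
        le := hU
        mem_Ioo := fun s hs x => ⟨by linarith [(he s x hs).1.1], by linarith [(he s x hs).1.2]⟩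
        tendsto := fun s hs x => (he s x hs).2 }
    have hρ' : ∀ d x a, 0 < ρ d x a := fun d x a => (hρ x a).trans_le (H.delay_zero_le hT d x a)
    refine ⟨⟨hp, fun x a => H.condVariance_nonneg hT hρ (hmoment x a), hvar, hr, hρ', hratio⟩, e,
      ⟨fun x => ?_, fun t ht htT => ?_⟩, H.tendsto⟩
    · refine tendsto_nhds_unique (H.tendsto 1 (by simp; omega) x)
        (tendsto_const_nhds.congr' (hU (eventually_probFilter_of_ae (P := P)
          (p := fun y : Σ k, Ω k => 1 / 2 = (E y.1).e 1 x y.2) fun k => ?_)))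
      exact (hdesign k).initial.mono fun ω hω => (hω x).symm
    · have ht' : t ∈ Finset.Icc 1 T := by simp; omega
      have hev : ∀ᶠ y in (U : Filter (Σ k, Ω k)), ∃ u,
          IsOptimalPlan δ T t ((E y.1).empiricalObjective T t y.2) u ∧
            ∀ x, (E y.1).e (t + 1) x y.2 = u (t + 1) x :=
        hU (eventually_probFilter_of_ae (P := P) fun k => (hdesign k).step t ht htT)
      -- The plans are chosen pointwise; limits along an ultrafilter require no measurability of
      -- this choice.
      obtain ⟨u, hu⟩ := hev.choice
      have hul : ∀ ℓ x, ∃ l, ℓ ∈ Finset.Icc (t + 1) T →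
          Tendsto (fun y : Σ k, Ω k => u y ℓ x) U (𝓝 l) := by
        intro ℓ x
        by_cases hℓ : ℓ ∈ Finset.Icc (t + 1) T
        · obtain ⟨l, -, hl⟩ := exists_tendsto_of_eventually_mem_Icc U
            (hu.mono fun y hy => hy.1.feasible ℓ hℓ x)
          exact ⟨l, fun _ => hl⟩
        · exact ⟨0, fun h => absurd h hℓ⟩
      choose w hw using hul
      refine ⟨w, ?_, fun x => ?_⟩
      · refine isOptimalPlan_of_tendsto hδ ht htT hr
          (fun d x a => by rw [conservative_eq _ ht]; exact hρ' _ x a)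
          (fun ℓ hℓ x => H.mem_Ioo ℓ (Finset.Icc_subset_Icc_right htT.le hℓ) x)
          (fun x => H.tendsto_pHat ht' x) (fun x a => H.tendsto_sigmaSqHat ht' hρ (hmoment x a))
          (fun ℓ hℓ => H.tendsto_rHat hℓ) (fun d x a => H.tendsto_rhoHat ht' d x a)
          (fun ℓ hℓ x => H.tendsto ℓ (Finset.Icc_subset_Icc_right htT.le hℓ) x)
          (fun ℓ hℓ x => hw ℓ x hℓ) (hu.mono fun y hy => hy.1)
      · exact tendsto_nhds_unique (H.tendsto (t + 1) (by simp; omega) x)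
          ((hw (t + 1) x (by simp; omega)).congr' (hu.mono fun y hy => (hy.2 x).symm))
  constructor
  · obtain ⟨-, e, he, -⟩ := main (Ultrafilter.of (probFilter P)) (Ultrafilter.of_le _)
    exact ⟨e, he⟩
  · intro eDag hDag t ht x a
    rw [tendstoInProb_iff]
    refine ((continuous_armProb a).tendsto _).comp ?_
    -- Convergence may be tested on finer ultrafilters, and uniqueness identifies each limit with
    -- `eDag`.
    rw [tendsto_iff_ultrafilter]
    intro U hU
    obtain ⟨hpop, e, he, hlim⟩ := main U hU
    rw [he.unique hpop hδ hδ' hDag t ht x |>.symm]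
    exact hlim t ht x
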